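/- Let $n\ge 0$ and let $B$ be an $n$-category freely generated by a set $I$ of $n$-cells: for $n>0$ this means that $B$ is a free extension, generated by $I$, of its $(n-1)$-st truncation; for $n=0$ it means that $I$ is the set of all $0$-cells. An extension of $B$ is an $(n+1)$-category whose $n$-th truncation is $B$. An extension $X$ is freely generated by $J\subseteq X_{n+1}$ if for every extension $Y$ of $B$ and every map $\varphi:J\to Y_{n+1}$ with $d\varphi x=dx$ and $c\varphi x=cx$ there is a unique $\omega$-functor $X\to Y$ that is the identity on the cells of $B$ and extends $\varphi$. The elements of $I$ and $J$ are called indets. An $(n+1)$-cell $u$ of an extension is many-to-one if $cu\in I$. Every $n$-cell $w$ of $B$ is denoted by a term built from indets $x\in I$, identities $1_a$ and compositions $\bullet_k$ ($k<n$). Fix for each $w$ such a term $t_w$; let $|w|$ be the finite set of the places of $t_w$ at which an indet occurs, and let $\langle w\rangle:|w|\to I$ give the indet at each place. For $r\in|w|$ with $\langle w\rangle(r)=x$, and a cell $v$ of an extension, of dimension $n$ or $n+1$, such that, if $n>0$, $d^{(n-1)}v=dx$ and $c^{(n-1)}v=cx$, let $w\,\square_r\,v$ be the cell obtained by putting $v$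 in the place $r$ of $t_w$ (when $\dim v=n+1$, the composition of $v$ with an $n$-cell $y$ is composition with $1_y$). For $n$-cells $v$, fix a proof, in the equational logic of $\omega$-categories, that the term obtained from $t_w$ by putting $t_v$ in the place $r$ equals $t_{w\square_r v}$; it identifies $|w\,\square_r\,v|$ with $(|w|\setminus\{r\})\sqcup|v|$. For an extension $X$ of $B$, the multicategory $\mathbb C_X$ has object set $I$; its arrows are the many-to-one $(n+1)$-cells $u$ of $X$, with source $\langle du\rangle$ and target $cu$; multicomposition is placed composition $u\circ_r v=u\bullet_n(du\,\square_r\,v)$, defined when $cv=\langle du\rangle(r)$, where $|d(u\circ_r v)|=(|du|\setminus\{r\})\sqcup|dv|$ by the identification above; the identity arrow of $x\in I$ is $1_x$. A morphism of multicategories $\chi:\mathbb C_X\to\mathbb C_Z$ consists of a map on objects, a map on arrows, and bijections $\theta_u$ from the index set of the source of $u$ to that of $\chi u$, which are compatible with sources, targets and identity arrows and satisfy $\chi(u\circ_r v)=\chi u\circ_{\theta_u r}\chi v$ and $\theta_{u\circ_r v}=\theta_u|_{|du|\setminus\{r\}}\sqcup\theta_v$. Let $X$ be an extension of $B$ freely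 generated by a set $J$ of many-to-one $(n+1)$-cells, let $Z$ be any extension of $B$, and let $\chi:\mathbb C_X\to\mathbb C_Z$ be a morphism of multicategories that is the identity on objects and satisfies, for every $f\in J$, $d\chi f=df$, $c\chi f=cf$ and $\theta_f=\mathrm{id}_{|df|}$. Then there is a unique $\omega$-functor $F:X\to Z$ that is the identity on the cells of $B$ and satisfies $Fu=\chi u$ for every many-to-one $(n+1)$-cell $u$ of $X$. If, moreover, $Z$ is also freely generated, as an extension of $B$, by a set of many-to-one $(n+1)$-cells, and $\chi$ is an isomorphism, then $F$ is an isomorphism. -/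

import Mathlib

universe u

namespace Computad

/-! ### Strict higher categories -/

/-- The operations of an `ω`-category: a set of `k`-cells for every `k`, domain and codomain,
identity cells and the compositions `•_k`.  The partial operation `•_k` on `m`-cells is recorded as
the function `comp k`, of which only the values at `k < m` and at `k`-composable pairs mean anything:
no law and no notion below looks at the other values. -/
structure PreCat : Type (u + 1) where
  cell : ℕ → Type u
  d : ∀ {k : ℕ}, cell (k + 1) → cell k
  c : ∀ {k : ℕ}, cell (k + 1) → cell k
  one : ∀ {k : ℕ}, cell k → cell (k + 1)
  comp : ∀ {m : ℕ} (_k : ℕ), cell m → cell m → cell m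

namespace PreCat

variable (B : PreCat.{u})

/-- The iterated domain `d^{(k)} x` of an `m`-cell, for `k ≤ m`. -/
def dIter {k m : ℕ} (h : k ≤ m) (x : B.cell m) : B.cell k :=
  Nat.decreasingInduction (motive := fun j _ => B.cell j) (fun _ _ y => B.d y) x h

/-- The iterated codomain `c^{(k)} x` of an `m`-cell, for `k ≤ m`. -/
def cIter {k m : ℕ} (h : k ≤ m) (x : B.cell m) : B.cell k :=
  Nat.decreasingInduction (motive := fun j _ => B.cell j) (fun _ _ y => B.c y) x h

/-- The iterated identity `1_a^{(m)}` of a `k`-cell, for `k ≤ m`. -/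
def oneIter {k m : ℕ} (h : k ≤ m) (a : B.cell k) : B.cell m :=
  Nat.leRecOn (C := B.cell) h (fun {_} y => B.one y) a

/-- Parallel cells; any two `0`-cells are parallel. -/
def Parallel : ∀ {n : ℕ}, B.cell n → B.cell n → Prop
  | 0, _, _ => True
  | _ + 1, x, y => B.d x = B.d y ∧ B.c x = B.c y

/-- The cells of the form `1_a`; there are none in dimension `0`. -/
def IsOne : ∀ {n : ℕ}, B.cell n → Prop
  | 0, _ => False
  | _ + 1, x => ∃ a, B.one a = x

/-- `d^{(k)} x = c^{(k)} y` for `n`-cells, `k ≤ n`. -/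
def Composable {n k : ℕ} (hk : k ≤ n) (x y : B.cell n) : Prop :=
  B.dIter hk x = B.cIter hk y

end PreCat

/-- Operations of a layer of `(n+1)`-cells lying over the cells of dimension `≤ n` of `B`. -/
structure Layer (B : PreCat.{u}) (n : ℕ) : Type (u + 1) where
  Top : Type u
  d : Top → B.cell n
  c : Top → B.cell n
  one : B.cell n → Top
  /-- `comp k` is `•_k`, for `k ≤ n`. -/
  comp : ℕ → Top → Top → Top

namespace Layer

variable {B : PreCat.{u}} {n : ℕ}

/-- The composite `x •_k y` of `(n+1)`-cells is defined: `d^{(k)} x = c^{(k)} y`. -/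
def Composable (X : Layer B n) {k : ℕ} (hk : k ≤ n) (x y : X.Top) : Prop :=
  B.dIter hk (X.d x) = B.cIter hk (X.c y)

/-- The axioms of strict higher categories, for the `(n+1)`-cells. -/
structure Lawful (X : Layer B n) : Prop where
  parallel : ∀ x, B.Parallel (X.d x) (X.c x)
  d_one : ∀ a, X.d (X.one a) = a
  c_one : ∀ a, X.c (X.one a) = a
  d_comp_top : ∀ x y, X.Composable le_rfl x y → X.d (X.comp n x y) = X.d y
  c_comp_top : ∀ x y, X.Composable le_rfl x y → X.c (X.comp n x y) = X.c x
  d_comp : ∀ {k} (hk : k < n) x y, X.Composable hk.le x y →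
    X.d (X.comp k x y) = B.comp k (X.d x) (X.d y)
  c_comp : ∀ {k} (hk : k < n) x y, X.Composable hk.le x y →
    X.c (X.comp k x y) = B.comp k (X.c x) (X.c y)
  assoc : ∀ {k} (hk : k ≤ n) x y z, X.Composable hk x y → X.Composable hk y z →
    X.comp k (X.comp k x y) z = X.comp k x (X.comp k y z)
  exchange : ∀ {l k} (hlk : l < k) (hk : k ≤ n) x x₁ y y₁,
    X.Composable hk x x₁ → X.Composable hk y y₁ → X.Composable (hlk.le.trans hk) x y →
    X.comp l (X.comp k x x₁) (X.comp k y y₁) = X.comp k (X.comp l x y) (X.comp l x₁ y₁)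
  one_comp : ∀ {k} (hk : k ≤ n) x,
    X.comp k (X.one (B.oneIter hk (B.cIter hk (X.c x)))) x = x
  comp_one : ∀ {k} (hk : k ≤ n) x,
    X.comp k x (X.one (B.oneIter hk (B.dIter hk (X.d x)))) = x
  one_comp_one : ∀ {k} (hk : k < n) (a b : B.cell n), B.Composable hk.le a b →
    X.comp k (X.one a) (X.one b) = X.one (B.comp k a b)

end Layer

/-- The `(m+1)`-cells of `B`, as a layer over the cells of dimension `≤ m`. -/
def PreCat.layer (B : PreCat.{u}) (m : ℕ) : Layer B m where
  Top := B.cell (m + 1)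
  d := B.d
  c := B.c
  one := B.one
  comp := fun k => B.comp k

/-- A strict `ω`-category. -/
structure OmegaCat : Type (u + 1) extends PreCat.{u} where
  lawful : ∀ m, (toPreCat.layer m).Lawful

/-- An extension of the `n`-category `B_n`, the `n`-th truncation of `B`: an `(n+1)`-category whose
`n`-th truncation is `B_n`.  Such an `(n+1)`-category is given by its `(n+1)`-cells and the operations
on them.  (Every `n`-category is the `n`-th truncation of an `ω`-category; the cells of `B` of
dimension `> n` play no role.) -/
structure Extension (B : OmegaCat.{u}) (n : ℕ) : Type (u + 1)
    extends Layer B.toPreCat n where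
  lawful : toLayer.Lawful

/-- An `ω`-functor `X → Z` between two extensions of `B_n` that is the identity on the cells of
`B_n`: it is given by its action on the `(n+1)`-cells. -/
@[ext]
structure ExtHom {B : OmegaCat.{u}} {n : ℕ} (X Z : Extension B n) : Type u where
  toFun : X.Top → Z.Top
  map_d : ∀ x, Z.d (toFun x) = X.d x
  map_c : ∀ x, Z.c (toFun x) = X.c x
  map_one : ∀ a, toFun (X.one a) = Z.one a
  map_comp : ∀ {k} (hk : k ≤ n) x y, X.Composable hk x y →
    toFun (X.comp k x y) = Z.comp k (toFun x) (toFun y)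

/-- `F` is an isomorphism: it has an inverse `ω`-functor. -/
def ExtHom.IsIso {B : OmegaCat.{u}} {n : ℕ} {X Z : Extension B n} (F : ExtHom X Z) : Prop :=
  ∃ G : ExtHom Z X, (∀ x, G.toFun (F.toFun x) = x) ∧ (∀ z, F.toFun (G.toFun z) = z)

/-- `X` is freely generated, as an extension of `B_n`, by the set `J` of its `(n+1)`-cells. -/
def Extension.FreelyGeneratedBy {B : OmegaCat.{u}} {n : ℕ} (X : Extension B n)
    (J : Set X.Top) : Prop :=
  ∀ (Y : Extension B n) (φ : J → Y.Top),
    (∀ x : J, Y.d (φ x) = X.d x ∧ Y.c (φ x) = X.c x) →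
    ∃! F : ExtHom X Y, ∀ x : J, F.toFun x = φ x

/-- `B_{m+1}` as an extension of `B_m`. -/
def OmegaCat.extension (B : OmegaCat.{u}) (m : ℕ) : Extension B m where
  toLayer := B.toPreCat.layer m
  lawful := B.lawful m

/-- The `n`-category `B_n` is freely generated by the set `I` of `n`-cells: for `n > 0` it is a free
extension of `B_{n-1}` generated by `I`, and for `n = 0`, `I` consists of all `0`-cells. -/
def OmegaCat.FreelyGeneratedBy (B : OmegaCat.{u}) : ∀ n : ℕ, Set (B.cell n) → Prop
  | 0, I => I = Set.univ
  | m + 1, I => (B.extension m).FreelyGeneratedBy I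

/-! ### Terms and occurrences of indeterminates -/

/-- Terms built from the indets in `I`, the identity symbols and the composition symbols `•_k`,
`k < n`.  `CTerm B n I w` is the type of the terms that denote the `n`-cell `w`.  (As `d 1_a = a`, the
symbol `1_a` is determined by the cell that it denotes.) -/
inductive CTerm (B : OmegaCat.{u}) (n : ℕ) (I : Set (B.cell n)) : B.cell n → Type u
  | indet (x : B.cell n) (hx : x ∈ I) : CTerm B n I x
  | one (e : B.cell n) (he : B.IsOne e) : CTerm B n I e
  | comp {v w : B.cell n} (k : ℕ) (hk : k < n) (h : B.Composable hk.le v w)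
      (t : CTerm B n I v) (s : CTerm B n I w) : CTerm B n I (B.comp k v w)

namespace CTerm

variable {B : OmegaCat.{u}} {n : ℕ} {I : Set (B.cell n)}

/-- The places of a term at which an indet occurs. -/
def Occ : ∀ {w : B.cell n}, CTerm B n I w → Type
  | _, indet _ _ => Unit
  | _, one _ _ => Empty
  | _, comp _ _ _ t s => t.Occ ⊕ s.Occ

/-- The indet that occurs at a given place. -/
def label : ∀ {w : B.cell n} (t : CTerm B n I w), t.Occ → I
  | _, indet x hx => fun _ => ⟨x, hx⟩
  | _, one _ _ => fun r => r.elim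
  | _, comp _ _ _ t s => fun r =>
    match r with
    | Sum.inl r => t.label r
    | Sum.inr r => s.label r

/-- `Proves t s χ`: in the equational system of strict higher categories there is a proof of `t = s`
that induces the bijection `χ` between the indet occurrences in `t` and those in `s`. -/
inductive Proves : ∀ {v w : B.cell n} (t : CTerm B n I v) (s : CTerm B n I w),
    t.Occ ≃ s.Occ → Prop
  | refl {v} (t : CTerm B n I v) : Proves t t (Equiv.refl _)
  | symm {v w} {t : CTerm B n I v} {s : CTerm B n I w} {χ} :
      Proves t s χ → Proves s t χ.symm
  | trans {v w z} {t : CTerm B n I v} {s : CTerm B n I w} {p : CTerm B n I z} {χ ψ} :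
      Proves t s χ → Proves s p ψ → Proves t p (χ.trans ψ)
  | congr_left {v v' w} {k} (hk : k < n) (h : B.Composable hk.le v w)
      (h' : B.Composable hk.le v' w) {t : CTerm B n I v} {t' : CTerm B n I v'} {χ}
      (s : CTerm B n I w) :
      Proves t t' χ →
        Proves (comp k hk h t s) (comp k hk h' t' s) (Equiv.sumCongr χ (Equiv.refl s.Occ))
  | congr_right {v w w'} {k} (hk : k < n) (h : B.Composable hk.le v w)
      (h' : B.Composable hk.le v w') (t : CTerm B n I v) {s : CTerm B n I w}
      {s' : CTerm B n I w'} {χ} :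
      Proves s s' χ →
        Proves (comp k hk h t s) (comp k hk h' t s') (Equiv.sumCongr (Equiv.refl t.Occ) χ)
  | assoc {v w z} {k} (hk : k < n) (h₁ : B.Composable hk.le v w)
      (h₂ : B.Composable hk.le (B.comp k v w) z) (h₃ : B.Composable hk.le w z)
      (h₄ : B.Composable hk.le v (B.comp k w z))
      (t : CTerm B n I v) (s : CTerm B n I w) (p : CTerm B n I z) :
      Proves (comp k hk h₂ (comp k hk h₁ t s) p) (comp k hk h₄ t (comp k hk h₃ s p))
        (Equiv.sumAssoc t.Occ s.Occ p.Occ)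
  | exchange {v v₁ w w₁} {l k} (hl : l < n) (hk : k < n) (hlk : l < k)
      (h₁ : B.Composable hk.le v v₁) (h₂ : B.Composable hk.le w w₁)
      (h₃ : B.Composable hl.le (B.comp k v v₁) (B.comp k w w₁))
      (h₄ : B.Composable hl.le v w) (h₅ : B.Composable hl.le v₁ w₁)
      (h₆ : B.Composable hk.le (B.comp l v w) (B.comp l v₁ w₁))
      (t : CTerm B n I v) (t₁ : CTerm B n I v₁) (s : CTerm B n I w) (s₁ : CTerm B n I w₁) :
      Proves (comp l hl h₃ (comp k hk h₁ t t₁) (comp k hk h₂ s s₁))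
        (comp k hk h₆ (comp l hl h₄ t s) (comp l hl h₅ t₁ s₁))
        (Equiv.sumSumSumComm t.Occ t₁.Occ s.Occ s₁.Occ)
  | one_comp {e v} {k} (hk : k < n) (he : B.IsOne e)
      (_ : e = B.oneIter hk.le (B.cIter hk.le v)) (h : B.Composable hk.le e v)
      (t : CTerm B n I v) :
      Proves (comp k hk h (one e he) t) t (Equiv.emptySum Empty t.Occ)
  | comp_one {e v} {k} (hk : k < n) (he : B.IsOne e)
      (_ : e = B.oneIter hk.le (B.dIter hk.le v)) (h : B.Composable hk.le v e)
      (t : CTerm B n I v) :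
      Proves (comp k hk h t (one e he)) t (Equiv.sumEmpty t.Occ Empty)
  | one_comp_one {e f} {k} (hk : k < n) (he : B.IsOne e) (hf : B.IsOne f)
      (hef : B.IsOne (B.comp k e f)) (h : B.Composable hk.le e f) :
      Proves (comp k hk h (one e he) (one f hf)) (one (B.comp k e f) hef)
        (Equiv.sumEmpty Empty Empty)

/-- The result of replacing the `r`-occurrence of an indet `x` in `t` by an `n`-cell (meaningful for
`n`-cells parallel to `x`). -/
def replace : ∀ {w : B.cell n} (t : CTerm B n I w), t.Occ → B.cell n → B.cell n
  | _, indet _ _ => fun _ v => v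
  | _, one _ _ => fun r _ => r.elim
  | _, comp (v := w₁) (w := w₂) k _ _ t s => fun r v =>
    match r with
    | Sum.inl r => B.comp k (t.replace r v) w₂
    | Sum.inr r => B.comp k w₁ (s.replace r v)

/-- Generalized whiskering: the result of replacing the `r`-occurrence of an indet `x` in `t` by an
`(n+1)`-cell `v` (meaningful if the domain and codomain of `v` are parallel to `x`).  Here
`v •_k w = v •_k 1_w` for an `n`-cell `w`, and likewise on the other side. -/
def whisker (X : Extension B n) : ∀ {w : B.cell n} (t : CTerm B n I w), t.Occ → X.Top → X.Top
  | _, indet _ _ => fun _ v => v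
  | _, one _ _ => fun r _ => r.elim
  | _, comp (v := w₁) (w := w₂) k _ _ t s => fun r v =>
    match r with
    | Sum.inl r => X.comp k (t.whisker X r v) (X.one w₂)
    | Sum.inr r => X.comp k (X.one w₁) (s.whisker X r v)

end CTerm

/-! Facts needed to see that the operations below are well typed. -/

namespace OmegaCat

variable {B : OmegaCat.{u}} {n : ℕ}

theorem parallel_refl (x : B.cell n) : B.Parallel x x := by
  cases n with
  | zero => trivial
  | succ m => exact ⟨rfl, rfl⟩

theorem parallel_symm {x y : B.cell n} (h : B.Parallel x y) : B.Parallel y x := by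
  cases n with
  | zero => trivial
  | succ m => exact ⟨h.1.symm, h.2.symm⟩

theorem parallel_trans {x y z : B.cell n} (h : B.Parallel x y) (h' : B.Parallel y z) :
    B.Parallel x z := by
  cases n with
  | zero => trivial
  | succ m => exact ⟨h.1.trans h'.1, h.2.trans h'.2⟩

theorem dIter_self (x : B.cell n) : B.dIter le_rfl x = x :=
  Nat.decreasingInduction_self _ _

theorem cIter_self (x : B.cell n) : B.cIter le_rfl x = x :=
  Nat.decreasingInduction_self _ _

theorem dIter_succ {k m : ℕ} (hk : k ≤ m) (h : k ≤ m + 1) (x : B.cell (m + 1)) :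
    B.dIter h x = B.dIter hk (B.d x) :=
  Nat.decreasingInduction_succ _ _ _ _

theorem cIter_succ {k m : ℕ} (hk : k ≤ m) (h : k ≤ m + 1) (x : B.cell (m + 1)) :
    B.cIter h x = B.cIter hk (B.c x) :=
  Nat.decreasingInduction_succ _ _ _ _

theorem Parallel.dIter_eq {x y : B.cell n} (h : B.Parallel x y) {k : ℕ} (hk : k < n) :
    B.dIter hk.le x = B.dIter hk.le y := by
  cases n with
  | zero => exact absurd hk (Nat.not_lt_zero _)
  | succ m => rw [dIter_succ (Nat.lt_succ_iff.1 hk), dIter_succ (Nat.lt_succ_iff.1 hk), h.1]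

theorem Parallel.cIter_eq {x y : B.cell n} (h : B.Parallel x y) {k : ℕ} (hk : k < n) :
    B.cIter hk.le x = B.cIter hk.le y := by
  cases n with
  | zero => exact absurd hk (Nat.not_lt_zero _)
  | succ m => rw [cIter_succ (Nat.lt_succ_iff.1 hk), cIter_succ (Nat.lt_succ_iff.1 hk), h.2]

theorem composable_congr {x x' y y' : B.cell n} (hx : B.Parallel x x') (hy : B.Parallel y y')
    {k : ℕ} (hk : k < n) (h : B.Composable hk.le x y) : B.Composable hk.le x' y' :=
  ((Parallel.dIter_eq hx hk).symm.trans h).trans (Parallel.cIter_eq hy hk)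

theorem parallel_comp {x x' y y' : B.cell n} (hx : B.Parallel x x') (hy : B.Parallel y y')
    {k : ℕ} (hk : k < n) (h : B.Composable hk.le x y) :
    B.Parallel (B.comp k x y) (B.comp k x' y') := by
  have h' := composable_congr hx hy hk h
  cases n with
  | zero => trivial
  | succ m =>
    have hk' : k ≤ m := Nat.lt_succ_iff.1 hk
    have c1 : (B.layer m).Composable hk' x y := by
      have := h
      rw [PreCat.Composable, dIter_succ hk', cIter_succ hk'] at this
      exact this
    have c2 : (B.layer m).Composable hk' x' y' := by
      have := h'
      rw [PreCat.Composable, dIter_succ hk', cIter_succ hk'] at this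
      exact this
    rcases hk'.eq_or_lt with rfl | hlt
    · exact ⟨((B.lawful k).d_comp_top x y c1).trans
          (hy.1.trans ((B.lawful k).d_comp_top x' y' c2).symm),
        ((B.lawful k).c_comp_top x y c1).trans
          (hx.2.trans ((B.lawful k).c_comp_top x' y' c2).symm)⟩
    · refine ⟨((B.lawful m).d_comp hlt x y c1).trans (Eq.trans ?_
          ((B.lawful m).d_comp hlt x' y' c2).symm),
        ((B.lawful m).c_comp hlt x y c1).trans (Eq.trans ?_
          ((B.lawful m).c_comp hlt x' y' c2).symm)⟩
      · exact congrArg₂ (B.comp k) hx.1 hy.1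
      · exact congrArg₂ (B.comp k) hx.2 hy.2

end OmegaCat

namespace CTerm

variable {B : OmegaCat.{u}} {n : ℕ} {I : Set (B.cell n)}

theorem replace_parallel {w : B.cell n} (t : CTerm B n I w) (r : t.Occ) (v : B.cell n)
    (hv : B.Parallel v (t.label r)) : B.Parallel (t.replace r v) w := by
  induction t with
  | indet x hx => exact hv
  | one e he => exact nomatch r
  | comp k hk h t s iht ihs =>
    rcases r with r | r
    · have h1 := iht r hv
      exact OmegaCat.parallel_comp h1 (OmegaCat.parallel_refl _) hk
        (OmegaCat.composable_congr (OmegaCat.parallel_symm h1) (OmegaCat.parallel_refl _) hk h)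
    · have h1 := ihs r hv
      exact OmegaCat.parallel_comp (OmegaCat.parallel_refl _) h1 hk
        (OmegaCat.composable_congr (OmegaCat.parallel_refl _) (OmegaCat.parallel_symm h1) hk h)

/-- The domain and codomain of a generalized whiskering. -/
theorem whisker_dc (X : Extension B n) {w : B.cell n} (t : CTerm B n I w) (r : t.Occ) (v : X.Top)
    (hv : X.c v = t.label r) :
    X.d (t.whisker X r v) = t.replace r (X.d v) ∧ X.c (t.whisker X r v) = w := by
  induction t with
  | indet x hx => exact ⟨rfl, hv⟩
  | one e he => exact nomatch r
  | @comp w₁ w₂ k hk h t s iht ihs =>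
    have hp := X.lawful.parallel v
    rcases r with r | r
    · have h1 := iht r hv
      have h2 : B.Parallel (t.replace r (X.d v)) w₁ :=
        replace_parallel t r _ (by have := hp; rw [hv] at this; exact this)
      have hc : X.Composable hk.le (t.whisker X r v) (X.one w₂) := by
        unfold Layer.Composable
        rw [h1.1, X.lawful.c_one, OmegaCat.Parallel.dIter_eq h2 hk]
        exact h
      refine ⟨(X.lawful.d_comp hk _ _ hc).trans ?_, (X.lawful.c_comp hk _ _ hc).trans ?_⟩
      · rw [h1.1, X.lawful.d_one]; rfl
      · rw [h1.2, X.lawful.c_one]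
    · have h1 := ihs r hv
      have hc : X.Composable hk.le (X.one w₁) (s.whisker X r v) := by
        unfold Layer.Composable
        rw [h1.2, X.lawful.d_one]
        exact h
      refine ⟨(X.lawful.d_comp hk _ _ hc).trans ?_, (X.lawful.c_comp hk _ _ hc).trans ?_⟩
      · rw [h1.1, X.lawful.d_one]; rfl
      · rw [h1.2, X.lawful.c_one]

/-- The term `t[s/r]` obtained from `t` by putting the term `s` in the place `r`; it denotes the cell
obtained by the replacement of the `r`-occurrence in `t` by the cell that `s` denotes. -/
def subst : ∀ {w : B.cell n} (t : CTerm B n I w) (r : t.Occ) {v : B.cell n}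
    (_ : CTerm B n I v), B.Parallel v (t.label r) → CTerm B n I (t.replace r v)
  | _, indet _ _ => fun _ _ s _ => s
  | _, one _ _ => fun r _ _ _ => r.elim
  | _, comp k hk h t p => fun r v s =>
    match r with
    | Sum.inl r => fun hv =>
      comp k hk (OmegaCat.composable_congr
        (OmegaCat.parallel_symm (replace_parallel t r v hv)) (OmegaCat.parallel_refl _) hk h)
        (t.subst r s hv) p
    | Sum.inr r => fun hv =>
      comp k hk (OmegaCat.composable_congr
        (OmegaCat.parallel_refl _) (OmegaCat.parallel_symm (replace_parallel p r v hv)) hk h)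
        t (p.subst r s hv)

/-- The places of `t` other than `r`, seen as places of `t[s/r]`. -/
def substOld : ∀ {w : B.cell n} (t : CTerm B n I w) (r : t.Occ) {v : B.cell n}
    (s : CTerm B n I v) (hv : B.Parallel v (t.label r)) (q : t.Occ), q ≠ r → (t.subst r s hv).Occ
  | _, indet _ _ => fun _ _ _ _ _ hq => (hq rfl).elim
  | _, one _ _ => fun r _ _ _ _ _ => r.elim
  | _, comp _ _ _ t p => fun r _ s =>
    match r with
    | Sum.inl r => fun hv q =>
      match q with
      | Sum.inl q => fun hq => Sum.inl (t.substOld r s hv q (fun e => hq (congrArg Sum.inl e)))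
      | Sum.inr q => fun _ => Sum.inr q
    | Sum.inr r => fun hv q =>
      match q with
      | Sum.inl q => fun _ => Sum.inl q
      | Sum.inr q => fun hq => Sum.inr (p.substOld r s hv q (fun e => hq (congrArg Sum.inr e)))

/-- The places of `s`, seen as places of `t[s/r]`. -/
def substNew : ∀ {w : B.cell n} (t : CTerm B n I w) (r : t.Occ) {v : B.cell n}
    (s : CTerm B n I v) (hv : B.Parallel v (t.label r)), s.Occ → (t.subst r s hv).Occ
  | _, indet _ _ => fun _ _ _ _ q => q
  | _, one _ _ => fun r _ _ _ _ => r.elim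
  | _, comp _ _ _ t p => fun r _ s =>
    match r with
    | Sum.inl r => fun hv q => Sum.inl (t.substNew r s hv q)
    | Sum.inr r => fun hv q => Sum.inr (p.substNew r s hv q)

end CTerm

/-- The choices on which the notion of indet occurrence in an `n`-cell rests: for every `n`-cell `w` a
preferred specification, that is, a term `term w` denoting `w`, whose places index the indet
occurrences in `w`; and, for every replacement of the `r`-occurrence in `w` by a cell `v`, the
bijection `chi` induced by some proof of `t_w[t_v/r] = t`, with `t` the preferred term of the resulting
cell.  Through `chi` the occurrences in `w` other than `r` and the occurrences in `v` become occurrences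
in the resulting cell.  When `B_n` is freely generated by `I`, such choices exist, since every cell is
denoted by a term and the equational system is complete. -/
structure Occurrences (B : OmegaCat.{u}) (n : ℕ) (I : Set (B.cell n)) : Type u where
  term : ∀ w : B.cell n, CTerm B n I w
  chi : ∀ (w : B.cell n) (r : (term w).Occ) (v : B.cell n)
    (hv : B.Parallel v ((term w).label r)),
    ((term w).subst r (term v) hv).Occ ≃ (term ((term w).replace r v)).Occ
  chi_proves : ∀ w r v hv,
    CTerm.Proves ((term w).subst r (term v) hv) (term ((term w).replace r v)) (chi w r v hv)

namespace Occurrences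

variable {B : OmegaCat.{u}} {n : ℕ} {I : Set (B.cell n)} (O : Occurrences B n I)

/-- The index set `|w|` of the indet occurrences in the `n`-cell `w`. -/
def Idx (w : B.cell n) : Type := (O.term w).Occ

/-- The indexed set `⟨w⟩ : |w| → I` of indet occurrences in `w`. -/
def label {w : B.cell n} (r : O.Idx w) : I := (O.term w).label r

/-- Equal cells have the same occurrences. -/
def castIdx {v w : B.cell n} (h : v = w) : O.Idx v ≃ O.Idx w := Equiv.cast (congrArg O.Idx h)

end Occurrences

/-! ### Multicategories and their morphisms -/

/-- The constituents of a multicategory: objects, object types, arrows `a` with a source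
`src a : Idx a → Obj` and a target, the multicompositions `u ⊙_r v`, the coprojections `old`, `new`
that exhibit the source of `u ⊙_r v` as made of the places of `u` other than `r` and the places of `v`,
and the identity arrows.  The notion of morphism depends on nothing else. -/
structure MulticatData : Type (u + 1) where
  Obj : Type u
  ObjType : Type u
  typeOf : Obj → ObjType
  Arr : Type u
  Idx : Arr → Type
  src : ∀ a, Idx a → Obj
  tgt : Arr → ObjType
  comp : ∀ (a : Arr) (r : Idx a) (b : Arr), tgt b = typeOf (src a r) → Arr
  old : ∀ (a : Arr) (r : Idx a) (b : Arr) (h : tgt b = typeOf (src a r)) (q : Idx a), q ≠ r →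
    Idx (comp a r b h)
  new : ∀ (a : Arr) (r : Idx a) (b : Arr) (h : tgt b = typeOf (src a r)), Idx b →
    Idx (comp a r b h)
  ident : Obj → Arr

/-- A morphism of multicategories, with its bijections `θ_a : |S a| → |S (χ a)|`. -/
structure MulticatHom (C D : MulticatData.{u}) : Type u where
  obj : C.Obj → D.Obj
  objType : C.ObjType → D.ObjType
  typeOf_obj : ∀ x, D.typeOf (obj x) = objType (C.typeOf x)
  arr : C.Arr → D.Arr
  theta : ∀ a, C.Idx a ≃ D.Idx (arr a)
  tgt_arr : ∀ a, D.tgt (arr a) = objType (C.tgt a)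
  src_arr : ∀ a r, D.src (arr a) (theta a r) = obj (C.src a r)
  arr_ident : ∀ x, arr (C.ident x) = D.ident (obj x)
  arr_comp : ∀ (a : C.Arr) (r : C.Idx a) (b : C.Arr) (h : C.tgt b = C.typeOf (C.src a r)),
    arr (C.comp a r b h) =
      D.comp (arr a) (theta a r) (arr b) (by rw [tgt_arr, src_arr, typeOf_obj, h])
  theta_old : ∀ (a : C.Arr) (r : C.Idx a) (b : C.Arr) (h : C.tgt b = C.typeOf (C.src a r))
    (q : C.Idx a) (hq : q ≠ r),
    (⟨_, theta _ (C.old a r b h q hq)⟩ : Σ e, D.Idx e) =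
      ⟨_, D.old (arr a) (theta a r) (arr b) (by rw [tgt_arr, src_arr, typeOf_obj, h])
        (theta a q) ((theta a).injective.ne hq)⟩
  theta_new : ∀ (a : C.Arr) (r : C.Idx a) (b : C.Arr) (h : C.tgt b = C.typeOf (C.src a r))
    (q : C.Idx b),
    (⟨_, theta _ (C.new a r b h q)⟩ : Σ e, D.Idx e) =
      ⟨_, D.new (arr a) (theta a r) (arr b) (by rw [tgt_arr, src_arr, typeOf_obj, h])
        (theta b q)⟩

/-- `χ` is an isomorphism: it has an inverse morphism. -/
def MulticatHom.IsIso {C D : MulticatData.{u}} (χ : MulticatHom C D) : Prop :=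
  ∃ ψ : MulticatHom D C,
    (∀ x, ψ.obj (χ.obj x) = x) ∧ (∀ y, χ.obj (ψ.obj y) = y) ∧
    (∀ x, ψ.objType (χ.objType x) = x) ∧ (∀ y, χ.objType (ψ.objType y) = y) ∧
    (∀ a, ψ.arr (χ.arr a) = a) ∧ (∀ b, χ.arr (ψ.arr b) = b)

/-! ### Placed composition -/

namespace Extension

variable {B : OmegaCat.{u}} {n : ℕ}

/-- The many-to-one `(n+1)`-cells: those whose codomain is an indet. -/
def ManyToOne (X : Extension B n) (I : Set (B.cell n)) : Type u := {x : X.Top // X.c x ∈ I}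

variable {I : Set (B.cell n)} (O : Occurrences B n I) (X : Extension B n)

/-- The placed composition `a ∘_r b = a •_n (da □_r b)` of `(n+1)`-cells. -/
def placedComp (a : X.Top) (r : O.Idx (X.d a)) (b : X.Top) : X.Top :=
  X.comp n a ((O.term (X.d a)).whisker X r b)

theorem placedComp_dc (a : X.Top) (r : O.Idx (X.d a)) (b : X.Top) (h : X.c b = O.label r) :
    X.d (X.placedComp O a r b) = (O.term (X.d a)).replace r (X.d b) ∧
      X.c (X.placedComp O a r b) = X.c a := by
  have hw := CTerm.whisker_dc X (O.term (X.d a)) r b h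
  have hc : X.Composable le_rfl a ((O.term (X.d a)).whisker X r b) := by
    unfold Layer.Composable
    rw [hw.2, OmegaCat.dIter_self, OmegaCat.cIter_self]
  exact ⟨(X.lawful.d_comp_top _ _ hc).trans hw.1, X.lawful.c_comp_top _ _ hc⟩

theorem d_parallel_label (a : X.Top) (r : O.Idx (X.d a)) (b : X.Top) (h : X.c b = O.label r) :
    B.Parallel (X.d b) ((O.term (X.d a)).label r) := by
  have := X.lawful.parallel b
  rw [h] at this
  exact this

/-- The multicategory of placed composition of `X`.  The objects, which are also the object types, are
the indets in `I`, the arrows are the many-to-one `(n+1)`-cells `a`, with source `⟨da⟩` and target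
`ca`, multicomposition is placed composition, and the identity arrows are the identity cells. -/
def multicat : MulticatData.{u} where
  Obj := I
  ObjType := I
  typeOf := id
  Arr := X.ManyToOne I
  Idx := fun a => O.Idx (X.d a.1)
  src := fun _ r => O.label r
  tgt := fun a => ⟨X.c a.1, a.2⟩
  comp := fun a r b h =>
    ⟨X.placedComp O a.1 r b.1, by
      rw [(X.placedComp_dc O a.1 r b.1 (congrArg Subtype.val h)).2]; exact a.2⟩
  old := fun a r b h q hq =>
    O.castIdx (X.placedComp_dc O a.1 r b.1 (congrArg Subtype.val h)).1.symm
      (O.chi _ r _ (X.d_parallel_label O a.1 r b.1 (congrArg Subtype.val h))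
        ((O.term (X.d a.1)).substOld r (O.term (X.d b.1)) _ q hq))
  new := fun a r b h q =>
    O.castIdx (X.placedComp_dc O a.1 r b.1 (congrArg Subtype.val h)).1.symm
      (O.chi _ r _ (X.d_parallel_label O a.1 r b.1 (congrArg Subtype.val h))
        ((O.term (X.d a.1)).substNew r (O.term (X.d b.1)) _ q))
  ident := fun x => ⟨X.one x.1, by rw [X.lawful.c_one]; exact x.2⟩

end Extension

end Computad

namespace Computad

/-! ### Laws for the `n`-cells of an `ω`-category -/

namespace OmegaCat

variable {B : OmegaCat.{u}} {n : ℕ}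

/-! Freeness of `X` leaves only one candidate: the functor `F` with `F f = χ f` for `f ∈ J`. The
task is to show that `F` and `χ` agree at every many-to-one cell. The statement that propagates
(`Agrees`) is stronger: `χ u = F u` and `θ_u` is the identity. Without control of `θ`, the law `χ (u
∘_r v) = χ u ∘_{θ r} χ v` would not say at which place the composition happens.

By interchange, every `(n+1)`-cell of `X` is a `•_n`-composite of identities and of generators
whiskered into terms (`whiskerGenerated`). A many-to-one cell `u` is `1_{cu} •_n u`. Starting from
`1_{cu}` and absorbing the factors of `u` one after another by associativity, each step is either
trivial or a composition `a •_n t[f]` with `f ∈ J` and `t` some term for `da`. Such a step is a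
placed composition `a ∘ f`, and agreement is stable under placed composition.

Recognizing `a •_n t[f]` as a placed composition requires comparing `t` with the preferred term of
`da`. The equational system is complete (`exists_proves`): terms modulo provable equality form an
extension of `B_{n-1}`, and the functor given by freeness of `B_n` sends a cell to the class of each
of its terms. Whiskering is invariant along the bijection that a proof induces
(`Proves.whisker_eq`), since each rule is matched by a law of `X`. Completeness also shows that an
indet has exactly one occurrence, so `θ` is the identity at `1_x`.

For the isomorphism, the inverse of `χ` prescribes a functor `G : Z → X` on the generators of `Z`.
Then `F G = 1` holds on generators, and `G F = 1` follows because `F`, agreeing with the bijection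
`χ`, is injective on many-to-one cells. -/

theorem composable_succ {m k : ℕ} (hk : k < m + 1) {x y : B.cell (m + 1)} :
    B.Composable hk.le x y ↔ (B.layer m).Composable (Nat.lt_succ_iff.1 hk) x y := by
  rw [PreCat.Composable, dIter_succ (Nat.lt_succ_iff.1 hk), cIter_succ (Nat.lt_succ_iff.1 hk)]
  rfl

theorem oneIter_succ {k m : ℕ} (hk : k ≤ m) (h : k ≤ m + 1) (a : B.cell k) :
    B.oneIter h a = B.one (B.oneIter hk a) :=
  Nat.leRecOn_succ hk a

theorem comp_assoc {k : ℕ} (hk : k < n) {x y z : B.cell n} (h : B.Composable hk.le x y)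
    (h' : B.Composable hk.le y z) :
    B.comp k (B.comp k x y) z = B.comp k x (B.comp k y z) := by
  cases n with
  | zero => exact absurd hk (Nat.not_lt_zero _)
  | succ m => exact (B.lawful m).assoc _ x y z ((composable_succ hk).1 h) ((composable_succ hk).1 h')

theorem comp_exchange {l k : ℕ} (hlk : l < k) (hk : k < n) {x x₁ y y₁ : B.cell n}
    (h : B.Composable hk.le x x₁) (h' : B.Composable hk.le y y₁)
    (h'' : B.Composable (hlk.trans hk).le x y) :
    B.comp l (B.comp k x x₁) (B.comp k y y₁) = B.comp k (B.comp l x y) (B.comp l x₁ y₁) := by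
  cases n with
  | zero => exact absurd hk (Nat.not_lt_zero _)
  | succ m =>
    exact (B.lawful m).exchange hlk (Nat.lt_succ_iff.1 hk) x x₁ y y₁ ((composable_succ hk).1 h)
      ((composable_succ hk).1 h') ((composable_succ (hlk.trans hk)).1 h'')

theorem oneIter_comp {k : ℕ} (hk : k < n) (x : B.cell n) :
    B.comp k (B.oneIter hk.le (B.cIter hk.le x)) x = x := by
  cases n with
  | zero => exact absurd hk (Nat.not_lt_zero _)
  | succ m =>
    rw [oneIter_succ (Nat.lt_succ_iff.1 hk), cIter_succ (Nat.lt_succ_iff.1 hk)]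
    exact (B.lawful m).one_comp _ x

theorem comp_oneIter {k : ℕ} (hk : k < n) (x : B.cell n) :
    B.comp k x (B.oneIter hk.le (B.dIter hk.le x)) = x := by
  cases n with
  | zero => exact absurd hk (Nat.not_lt_zero _)
  | succ m =>
    rw [oneIter_succ (Nat.lt_succ_iff.1 hk), dIter_succ (Nat.lt_succ_iff.1 hk)]
    exact (B.lawful m).comp_one _ x

theorem parallel_d_c {m : ℕ} (x : B.cell (m + 1)) : B.Parallel (B.d x) (B.c x) :=
  (B.lawful m).parallel x

theorem Composable.d {m k : ℕ} (hk : k < m) {x y : B.cell (m + 1)}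
    (h : B.Composable (Nat.le_succ_of_le hk.le) x y) : B.Composable hk.le (B.d x) (B.d y) := by
  have h' := (composable_succ (Nat.lt_succ_of_lt hk)).1 h
  exact h'.trans (Parallel.cIter_eq (parallel_d_c y) hk).symm

theorem Composable.c {m k : ℕ} (hk : k < m) {x y : B.cell (m + 1)}
    (h : B.Composable (Nat.le_succ_of_le hk.le) x y) : B.Composable hk.le (B.c x) (B.c y) := by
  have h' := (composable_succ (Nat.lt_succ_of_lt hk)).1 h
  exact (Parallel.dIter_eq (parallel_d_c x) hk).symm.trans h'

theorem Composable.top {m : ℕ} {x y : B.cell (m + 1)}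
    (h : B.Composable (Nat.le_succ m) x y) : B.d x = B.c y := by
  have h' := (composable_succ (Nat.lt_succ_self m)).1 h
  unfold Layer.Composable at h'
  rwa [dIter_self, cIter_self] at h'

theorem dIter_comp_right {l k : ℕ} (hl : l ≤ k) (hk : k < n) {x y : B.cell n}
    (h : B.Composable hk.le x y) :
    B.dIter (hl.trans hk.le) (B.comp k x y) = B.dIter (hl.trans hk.le) y := by
  induction n with
  | zero => exact absurd hk (Nat.not_lt_zero _)
  | succ m ih =>
    have hc := (composable_succ hk).1 h
    have hk' := Nat.lt_succ_iff.1 hk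
    rw [dIter_succ (hl.trans hk'), dIter_succ (hl.trans hk')]
    rcases hk'.eq_or_lt with rfl | hlt
    · exact congrArg _ ((B.lawful k).d_comp_top x y hc)
    · exact (congrArg _ ((B.lawful m).d_comp hlt x y hc)).trans (ih hlt (Composable.d hlt h))

theorem cIter_comp_left {l k : ℕ} (hl : l ≤ k) (hk : k < n) {x y : B.cell n}
    (h : B.Composable hk.le x y) :
    B.cIter (hl.trans hk.le) (B.comp k x y) = B.cIter (hl.trans hk.le) x := by
  induction n with
  | zero => exact absurd hk (Nat.not_lt_zero _)
  | succ m ih =>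
    have hc := (composable_succ hk).1 h
    have hk' := Nat.lt_succ_iff.1 hk
    rw [cIter_succ (hl.trans hk'), cIter_succ (hl.trans hk')]
    rcases hk'.eq_or_lt with rfl | hlt
    · exact congrArg _ ((B.lawful k).c_comp_top x y hc)
    · exact (congrArg _ ((B.lawful m).c_comp hlt x y hc)).trans (ih hlt (Composable.c hlt h))

/-- By globularity, `k`-composable cells share their boundaries below dimension `k`. This and
`Composable.cIter_eq` supply the fourth composability condition in the exchange law. -/
theorem Composable.dIter_eq {l k : ℕ} (hl : l < k) (hk : k < n) {x y : B.cell n}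
    (h : B.Composable hk.le x y) : B.dIter (hl.trans hk).le x = B.dIter (hl.trans hk).le y := by
  induction n with
  | zero => exact absurd hk (Nat.not_lt_zero _)
  | succ m ih =>
    have hk' := Nat.lt_succ_iff.1 hk
    rw [dIter_succ (hl.le.trans hk'), dIter_succ (hl.le.trans hk')]
    rcases hk'.eq_or_lt with rfl | hlt
    · rw [Composable.top h, Parallel.dIter_eq (parallel_d_c y) hl]
    · exact ih hlt (Composable.d hlt h)

theorem Composable.cIter_eq {l k : ℕ} (hl : l < k) (hk : k < n) {x y : B.cell n}
    (h : B.Composable hk.le x y) : B.cIter (hl.trans hk).le x = B.cIter (hl.trans hk).le y := by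
  induction n with
  | zero => exact absurd hk (Nat.not_lt_zero _)
  | succ m ih =>
    have hk' := Nat.lt_succ_iff.1 hk
    rw [cIter_succ (hl.le.trans hk'), cIter_succ (hl.le.trans hk')]
    rcases hk'.eq_or_lt with rfl | hlt
    · rw [← Composable.top h, Parallel.cIter_eq (parallel_d_c x) hl]
    · exact ih hlt (Composable.c hlt h)

theorem dIter_comp {l k : ℕ} (hl : l < k) (hk : k ≤ n) {x y : B.cell n}
    (h : B.Composable (hl.le.trans hk) x y) :
    B.dIter hk (B.comp l x y) = B.comp l (B.dIter hk x) (B.dIter hk y) := by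
  induction n with
  | zero => exact absurd (hl.trans_le hk) (Nat.not_lt_zero _)
  | succ m ih =>
    rcases hk.eq_or_lt with rfl | hlt
    · simp only [dIter_self]
    · have hk' := Nat.lt_succ_iff.1 hlt
      have hlm := hl.trans_le hk'
      rw [dIter_succ hk', dIter_succ hk', dIter_succ hk', ← ih hk' (Composable.d hlm h)]
      exact congrArg _ ((B.lawful m).d_comp hlm x y ((composable_succ (hl.trans hlt)).1 h))

theorem cIter_comp {l k : ℕ} (hl : l < k) (hk : k ≤ n) {x y : B.cell n}
    (h : B.Composable (hl.le.trans hk) x y) :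
    B.cIter hk (B.comp l x y) = B.comp l (B.cIter hk x) (B.cIter hk y) := by
  induction n with
  | zero => exact absurd (hl.trans_le hk) (Nat.not_lt_zero _)
  | succ m ih =>
    rcases hk.eq_or_lt with rfl | hlt
    · simp only [cIter_self]
    · have hk' := Nat.lt_succ_iff.1 hlt
      have hlm := hl.trans_le hk'
      rw [cIter_succ hk', cIter_succ hk', cIter_succ hk', ← ih hk' (Composable.c hlm h)]
      exact congrArg _ ((B.lawful m).c_comp hlm x y ((composable_succ (hl.trans hlt)).1 h))

theorem dIter_oneIter {k : ℕ} (hk : k ≤ n) (a : B.cell k) : B.dIter hk (B.oneIter hk a) = a := by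
  induction n, hk using Nat.le_induction with
  | base => rw [dIter_self, PreCat.oneIter, Nat.leRecOn_self]
  | succ m hm ih =>
    rw [oneIter_succ hm, dIter_succ hm, show B.d (B.one _) = _ from (B.lawful m).d_one _, ih]

theorem cIter_oneIter {k : ℕ} (hk : k ≤ n) (a : B.cell k) : B.cIter hk (B.oneIter hk a) = a := by
  induction n, hk using Nat.le_induction with
  | base => rw [cIter_self, PreCat.oneIter, Nat.leRecOn_self]
  | succ m hm ih =>
    rw [oneIter_succ hm, cIter_succ hm, show B.c (B.one _) = _ from (B.lawful m).c_one _, ih]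

end OmegaCat

/-! ### Composability and top-dimensional units in a layer -/

namespace Layer

variable {B : OmegaCat.{u}} {n : ℕ} {X : Layer B.toPreCat n}

/-- Below the top dimension, composability depends only on the codomains. -/
theorem Lawful.composable_iff (hX : X.Lawful) {k : ℕ} (hk : k < n) {x y : X.Top} :
    X.Composable hk.le x y ↔ B.Composable hk.le (X.c x) (X.c y) := by
  unfold Layer.Composable PreCat.Composable
  rw [OmegaCat.Parallel.dIter_eq (hX.parallel x) hk]

theorem composable_top {x y : X.Top} : X.Composable le_rfl x y ↔ X.d x = X.c y := by
  unfold Layer.Composable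
  rw [OmegaCat.dIter_self, OmegaCat.cIter_self]

theorem Lawful.one_comp_top (hX : X.Lawful) (x : X.Top) : X.comp n (X.one (X.c x)) x = x := by
  have := hX.one_comp le_rfl x
  rwa [OmegaCat.cIter_self, PreCat.oneIter, Nat.leRecOn_self] at this

theorem Lawful.comp_one_top (hX : X.Lawful) (x : X.Top) : X.comp n x (X.one (X.d x)) = x := by
  have := hX.comp_one le_rfl x
  rwa [OmegaCat.dIter_self, PreCat.oneIter, Nat.leRecOn_self] at this

end Layer

/-! ### Soundness of the equational system -/

namespace CTerm

variable {B : OmegaCat.{u}} {n : ℕ} {I : Set (B.cell n)}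

/-- Each rule is a law of `B`. Hence a proof may be treated as relating two terms for one and the
same cell. -/
theorem Proves.cell_eq {v w : B.cell n} {t : CTerm B n I v} {s : CTerm B n I w}
    {χ : t.Occ ≃ s.Occ} (h : Proves t s χ) : v = w := by
  induction h with
  | refl => rfl
  | symm _ ih => exact ih.symm
  | trans _ _ ih₁ ih₂ => exact ih₁.trans ih₂
  | congr_left _ _ _ _ _ ih => rw [ih]
  | congr_right _ _ _ _ _ ih => rw [ih]
  | assoc hk h₁ _ h₃ => exact OmegaCat.comp_assoc hk h₁ h₃
  | exchange _ hk hlk h₁ h₂ _ h₄ => exact OmegaCat.comp_exchange hlk hk h₁ h₂ h₄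
  | one_comp hk _ he => rw [he]; exact OmegaCat.oneIter_comp hk _
  | comp_one hk _ he => rw [he]; exact OmegaCat.comp_oneIter hk _
  | one_comp_one => rfl

/-- No rule alters an indet; it only moves, adds or removes symbols without occurrences. A cell that
fits the place `r` therefore fits its image under the bijection. -/
theorem Proves.label_eq {v w : B.cell n} {t : CTerm B n I v} {s : CTerm B n I w}
    {χ : t.Occ ≃ s.Occ} (h : Proves t s χ) (r : t.Occ) : s.label (χ r) = t.label r := by
  induction h with
  | refl => rfl
  | @symm _ _ _ _ χ _ ih => rw [← ih, Equiv.apply_symm_apply]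
  | trans _ _ ih₁ ih₂ => exact (ih₂ _).trans (ih₁ _)
  | congr_left _ _ _ _ _ ih =>
    rcases r with r | r
    · exact ih r
    · rfl
  | congr_right _ _ _ _ _ ih =>
    rcases r with r | r
    · rfl
    · exact ih r
  | assoc => rcases r with (r | r) | r <;> rfl
  | exchange => rcases r with (r | r) | (r | r) <;> rfl
  | one_comp =>
    rcases r with r | r
    · exact nomatch r
    · rfl
  | comp_one =>
    rcases r with r | r
    · rfl
    · exact nomatch r
  | one_comp_one => rcases r with r | r <;> exact nomatch r

/-- Generalized whiskering is invariant under provable equality of terms. -/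
theorem Proves.whisker_eq (X : Extension B n) {v w : B.cell n} {t : CTerm B n I v}
    {s : CTerm B n I w} {χ : t.Occ ≃ s.Occ} (h : Proves t s χ) (r : t.Occ) (a : X.Top)
    (ha : X.c a = t.label r) : t.whisker X r a = s.whisker X (χ r) a := by
  have hX := X.lawful
  induction h with
  | refl => rfl
  | symm h ih =>
    rw [ih, Equiv.apply_symm_apply]
    rw [ha, ← h.label_eq, Equiv.apply_symm_apply]
  | trans h₁ h₂ ih₁ ih₂ => exact (ih₁ r ha).trans (ih₂ _ (by rw [ha, h₁.label_eq]))
  | congr_left hk _ _ s h ih =>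
    rcases r with r | r
    · exact congrArg (X.comp _ · _) (ih r ha)
    -- The whiskering takes place in the other factor, and the rewritten term enters only through
    -- the cell it denotes.
    · cases h.cell_eq
      rfl
  | congr_right hk _ _ s h ih =>
    rcases r with r | r
    · cases h.cell_eq
      rfl
    · exact congrArg (X.comp _ _) (ih r ha)
  | @assoc v w z k hk h₁ h₂ h₃ h₄ t s p =>
    rcases r with (r | r) | r
    · have hc := (whisker_dc X t r a ha).2
      change X.comp k (X.comp k (t.whisker X r a) (X.one w)) (X.one z) =
        X.comp k (t.whisker X r a) (X.one (B.comp k w z))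
      -- Splitting the identity of a composite into a composite of identities leaves an instance of
      -- the same law in `X`. As `k < n`, the side conditions involve codomains only, and a
      -- whiskering of `t` has as codomain the cell denoted by `t`. The remaining associativity and
      -- exchange cases rest on the same computation.
      rw [← hX.one_comp_one hk w z h₃, hX.assoc hk.le] <;>
        simpa only [hX.composable_iff hk, hX.c_one, hc]
    · have hc := (whisker_dc X s r a ha).2
      change X.comp k (X.comp k (X.one v) (s.whisker X r a)) (X.one z) =
        X.comp k (X.one v) (X.comp k (s.whisker X r a) (X.one z))
      rw [hX.assoc hk.le] <;> simpa only [hX.composable_iff hk, hX.c_one, hc]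
    · have hc := (whisker_dc X p r a ha).2
      change X.comp k (X.one (B.comp k v w)) (p.whisker X r a) =
        X.comp k (X.one v) (X.comp k (X.one w) (p.whisker X r a))
      rw [← hX.one_comp_one hk v w h₁, hX.assoc hk.le] <;>
        simpa only [hX.composable_iff hk, hX.c_one, hc]
  | @exchange v v₁ w w₁ l k hl hk hlk h₁ h₂ h₃ h₄ h₅ h₆ t t₁ s s₁ =>
    rcases r with (r | r) | (r | r)
    · have hc := (whisker_dc X t r a ha).2
      change X.comp l (X.comp k (t.whisker X r a) (X.one v₁)) (X.one (B.comp k w w₁)) =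
        X.comp k (X.comp l (t.whisker X r a) (X.one w)) (X.one (B.comp l v₁ w₁))
      rw [← hX.one_comp_one hk w w₁ h₂, ← hX.one_comp_one hl v₁ w₁ h₅,
        hX.exchange hlk hk.le] <;>
        simpa only [hX.composable_iff hk, hX.composable_iff hl, hX.c_one, hc]
    · have hc := (whisker_dc X t₁ r a ha).2
      change X.comp l (X.comp k (X.one v) (t₁.whisker X r a)) (X.one (B.comp k w w₁)) =
        X.comp k (X.one (B.comp l v w)) (X.comp l (t₁.whisker X r a) (X.one w₁))
      rw [← hX.one_comp_one hk w w₁ h₂, ← hX.one_comp_one hl v w h₄,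
        hX.exchange hlk hk.le] <;>
        simpa only [hX.composable_iff hk, hX.composable_iff hl, hX.c_one, hc]
    · have hc := (whisker_dc X s r a ha).2
      change X.comp l (X.one (B.comp k v v₁)) (X.comp k (s.whisker X r a) (X.one w₁)) =
        X.comp k (X.comp l (X.one v) (s.whisker X r a)) (X.one (B.comp l v₁ w₁))
      rw [← hX.one_comp_one hk v v₁ h₁, ← hX.one_comp_one hl v₁ w₁ h₅,
        hX.exchange hlk hk.le] <;>
        simpa only [hX.composable_iff hk, hX.composable_iff hl, hX.c_one, hc]
    · have hc := (whisker_dc X s₁ r a ha).2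
      change X.comp l (X.one (B.comp k v v₁)) (X.comp k (X.one w) (s₁.whisker X r a)) =
        X.comp k (X.one (B.comp l v w)) (X.comp l (X.one v₁) (s₁.whisker X r a))
      rw [← hX.one_comp_one hk v v₁ h₁, ← hX.one_comp_one hl v w h₄,
        hX.exchange hlk hk.le] <;>
        simpa only [hX.composable_iff hk, hX.composable_iff hl, hX.c_one, hc]
  | @one_comp e v k hk he he' h t =>
    rcases r with r | r
    · exact nomatch r
    · have hc := (whisker_dc X t r a ha).2
      have := hX.one_comp hk.le (t.whisker X r a)
      rw [hc, ← he'] at this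
      exact this
  | @comp_one e v k hk he he' h t =>
    rcases r with r | r
    · have hc := (whisker_dc X t r a ha).2
      have := hX.comp_one hk.le (t.whisker X r a)
      -- The unit law of `X` uses the domain of the whiskered cell, while the term refers to its
      -- codomain `v`; below dimension `n` these have the same iterated domain.
      rw [OmegaCat.Parallel.dIter_eq (hX.parallel _) hk, hc, ← he'] at this
      exact this
    · exact nomatch r
  | one_comp_one => rcases r with r | r <;> exact nomatch r

/-! ### Completeness of the equational system -/

/-- Terms up to provable equality. -/
def provableSetoid (B : OmegaCat.{u}) (n : ℕ) (I : Set (B.cell n)) :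
    Setoid (Σ w, CTerm B n I w) where
  r a b := ∃ χ, Proves a.2 b.2 χ
  iseqv :=
    { refl := fun a => ⟨_, Proves.refl a.2⟩
      symm := fun ⟨_, h⟩ => ⟨_, h.symm⟩
      trans := fun ⟨_, h⟩ ⟨_, h'⟩ => ⟨_, h.trans h'⟩ }

/-- Terms up to provable equality. -/
def TermClass (B : OmegaCat.{u}) (n : ℕ) (I : Set (B.cell n)) : Type u :=
  Quotient (provableSetoid B n I)

namespace TermClass

/-- The class of a term. -/
def mk {w : B.cell n} (t : CTerm B n I w) : TermClass B n I :=
  Quotient.mk (provableSetoid B n I) ⟨w, t⟩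

theorem mk_eq_mk {v w : B.cell n} {t : CTerm B n I v} {s : CTerm B n I w} :
    mk t = mk s ↔ ∃ χ, Proves t s χ :=
  Quotient.eq (r := provableSetoid B n I)

theorem ind {p : TermClass B n I → Prop} (h : ∀ w (t : CTerm B n I w), p (mk t)) (x) : p x :=
  Quotient.inductionOn x fun a => h a.1 a.2

/-- The cell denoted by the terms of a class. -/
def cell (x : TermClass B n I) : B.cell n :=
  Quotient.lift (s := provableSetoid B n I) Sigma.fst (fun _ _ ⟨_, h⟩ => h.cell_eq) x

open Classical in
/-- Composition of classes of terms. -/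
noncomputable def comp (k : ℕ) (x y : TermClass B n I) : TermClass B n I :=
  Quotient.liftOn₂ (s₁ := provableSetoid B n I) (s₂ := provableSetoid B n I) x y
    -- For pairs that are not composable the value is arbitrary; the left factor serves.
    (fun a b => if h : ∃ hk : k < n, B.Composable hk.le a.1 b.1 then
      mk (CTerm.comp k h.1 h.2 a.2 b.2) else mk a.2)
    (by
      rintro ⟨v, t⟩ ⟨w, s⟩ ⟨v', t'⟩ ⟨w', s'⟩ ⟨χ, h⟩ ⟨ψ, h'⟩
      dsimp only at h h' ⊢
      cases h.cell_eq
      cases h'.cell_eq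
      split_ifs with hc
      · exact mk_eq_mk.2 ⟨_, (Proves.congr_left hc.1 hc.2 hc.2 s h).trans
          (Proves.congr_right hc.1 hc.2 hc.2 t' h')⟩
      · exact mk_eq_mk.2 ⟨_, h⟩)

theorem comp_mk {k : ℕ} (hk : k < n) {v w : B.cell n} (h : B.Composable hk.le v w)
    (t : CTerm B n I v) (s : CTerm B n I w) : comp k (mk t) (mk s) = mk (t.comp k hk h s) :=
  dif_pos (⟨hk, h⟩ : ∃ hk : k < n, B.Composable hk.le v w)

theorem cell_comp {k : ℕ} (hk : k < n) {x y : TermClass B n I}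
    (h : B.Composable hk.le x.cell y.cell) : (comp k x y).cell = B.comp k x.cell y.cell := by
  induction x using ind with | _ v t
  induction y using ind with | _ w s
  exact congrArg cell (comp_mk hk h t s)

end TermClass

/-- The extension of `B_m` whose `(m+1)`-cells are terms up to provable equality. -/
noncomputable def termLayer (B : OmegaCat.{u}) (m : ℕ) (I : Set (B.cell (m + 1))) :
    Layer B.toPreCat m where
  Top := TermClass B (m + 1) I
  d x := B.d x.cell
  c x := B.c x.cell
  one a := TermClass.mk (one (B.one a) ⟨a, rfl⟩)
  comp := TermClass.comp

theorem termLayer_composable {m : ℕ} {I : Set (B.cell (m + 1))} {k : ℕ} (hk : k ≤ m)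
    {x y : TermClass B (m + 1) I} : (termLayer B m I).Composable hk x y ↔
      B.Composable (Nat.lt_succ_of_le hk).le x.cell y.cell :=
  (OmegaCat.composable_succ (Nat.lt_succ_of_le hk)).symm

/-- The laws about boundaries are inherited from `B` through the denoted cell, and the remaining
laws are the rules of `Proves`. What needs checking is that both sides of each rule are legitimate
terms. -/
theorem termLayer_lawful (B : OmegaCat.{u}) (m : ℕ) (I : Set (B.cell (m + 1))) :
    (termLayer B m I).Lawful where
  parallel x := (B.lawful m).parallel x.cell
  d_one a := (B.lawful m).d_one a
  c_one a := (B.lawful m).c_one a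
  d_comp_top x y h := (congrArg B.d (TermClass.cell_comp (Nat.lt_succ_self m)
    ((termLayer_composable le_rfl).1 h))).trans ((B.lawful m).d_comp_top x.cell y.cell h)
  c_comp_top x y h := (congrArg B.c (TermClass.cell_comp (Nat.lt_succ_self m)
    ((termLayer_composable le_rfl).1 h))).trans ((B.lawful m).c_comp_top x.cell y.cell h)
  d_comp hk x y h := (congrArg B.d (TermClass.cell_comp (hk.trans (Nat.lt_succ_self m))
    ((termLayer_composable hk.le).1 h))).trans ((B.lawful m).d_comp hk x.cell y.cell h)
  c_comp hk x y h := (congrArg B.c (TermClass.cell_comp (hk.trans (Nat.lt_succ_self m))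
    ((termLayer_composable hk.le).1 h))).trans ((B.lawful m).c_comp hk x.cell y.cell h)
  assoc {k} hk x y z h h' := by
    replace h := (termLayer_composable hk).1 h
    replace h' := (termLayer_composable hk).1 h'
    induction x using TermClass.ind with | _ u t
    induction y using TermClass.ind with | _ v s
    induction z using TermClass.ind with | _ w p
    have hk' := Nat.lt_succ_of_le hk
    change B.Composable hk'.le u v at h
    change B.Composable hk'.le v w at h'
    have h₁ : B.Composable hk'.le (B.comp k u v) w :=
      (OmegaCat.dIter_comp_right le_rfl hk' h).trans h'
    have h₂ : B.Composable hk'.le u (B.comp k v w) :=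
      h.trans (OmegaCat.cIter_comp_left le_rfl hk' h').symm
    change TermClass.comp k (TermClass.comp k (.mk t) (.mk s)) (.mk p) =
      TermClass.comp k (.mk t) (TermClass.comp k (.mk s) (.mk p))
    rw [TermClass.comp_mk hk' h, TermClass.comp_mk hk' h', TermClass.comp_mk hk' h₁,
      TermClass.comp_mk hk' h₂]
    exact TermClass.mk_eq_mk.2 ⟨_, Proves.assoc hk' h h₁ h' h₂ t s p⟩
  exchange {l k} hlk hk x x₁ y y₁ h h' h'' := by
    replace h := (termLayer_composable hk).1 h
    replace h' := (termLayer_composable hk).1 h'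
    replace h'' := (termLayer_composable (hlk.le.trans hk)).1 h''
    induction x using TermClass.ind with | _ v t
    induction x₁ using TermClass.ind with | _ v₁ t₁
    induction y using TermClass.ind with | _ w s
    induction y₁ using TermClass.ind with | _ w₁ s₁
    have hk' := Nat.lt_succ_of_le hk
    have hl' := hlk.trans hk'
    change B.Composable hk'.le v v₁ at h
    change B.Composable hk'.le w w₁ at h'
    change B.Composable hl'.le v w at h''
    -- The exchange axiom assumes three composabilities, the rule also needs this one; it follows
    -- since `v`, `v₁` and `w`, `w₁` have common boundaries below dimension `k`.
    have h₁ : B.Composable hl'.le v₁ w₁ :=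
      ((OmegaCat.Composable.dIter_eq hlk hk' h).symm.trans h'').trans
        (OmegaCat.Composable.cIter_eq hlk hk' h')
    have h₂ : B.Composable hl'.le (B.comp k v v₁) (B.comp k w w₁) :=
      ((OmegaCat.dIter_comp_right hlk.le hk' h).trans
        (OmegaCat.Composable.dIter_eq hlk hk' h).symm).trans
        (h''.trans (OmegaCat.cIter_comp_left hlk.le hk' h').symm)
    have h₃ : B.Composable hk'.le (B.comp l v w) (B.comp l v₁ w₁) :=
      (OmegaCat.dIter_comp hlk hk'.le h'').trans ((congrArg₂ _ h h').trans
        (OmegaCat.cIter_comp hlk hk'.le h₁).symm)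
    change TermClass.comp l (TermClass.comp k (.mk t) (.mk t₁))
        (TermClass.comp k (.mk s) (.mk s₁)) =
      TermClass.comp k (TermClass.comp l (.mk t) (.mk s)) (TermClass.comp l (.mk t₁) (.mk s₁))
    rw [TermClass.comp_mk hk' h, TermClass.comp_mk hk' h', TermClass.comp_mk hl' h'',
      TermClass.comp_mk hl' h₁, TermClass.comp_mk hl' h₂, TermClass.comp_mk hk' h₃]
    exact TermClass.mk_eq_mk.2 ⟨_, Proves.exchange hl' hk' hlk h h' h₂ h'' h₁ h₃ t t₁ s s₁⟩
  one_comp {k} hk x := by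
    induction x using TermClass.ind with | _ v t
    have hk' := Nat.lt_succ_of_le hk
    have he : B.one (B.oneIter hk (B.cIter hk (B.c v))) =
        B.oneIter hk'.le (B.cIter hk'.le v) := by
      rw [OmegaCat.oneIter_succ hk, OmegaCat.cIter_succ hk]
    have h : B.Composable hk'.le (B.one (B.oneIter hk (B.cIter hk (B.c v)))) v := by
      rw [he]
      exact OmegaCat.dIter_oneIter _ _
    exact (TermClass.comp_mk hk' h _ t).trans
      (TermClass.mk_eq_mk.2 ⟨_, Proves.one_comp hk' _ he h t⟩)
  comp_one {k} hk x := by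
    induction x using TermClass.ind with | _ v t
    have hk' := Nat.lt_succ_of_le hk
    have he : B.one (B.oneIter hk (B.dIter hk (B.d v))) =
        B.oneIter hk'.le (B.dIter hk'.le v) := by
      rw [OmegaCat.oneIter_succ hk, OmegaCat.dIter_succ hk]
    have h : B.Composable hk'.le v (B.one (B.oneIter hk (B.dIter hk (B.d v)))) := by
      rw [he]
      exact (OmegaCat.cIter_oneIter _ _).symm
    exact (TermClass.comp_mk hk' h t _).trans
      (TermClass.mk_eq_mk.2 ⟨_, Proves.comp_one hk' _ he h t⟩)
  one_comp_one {k} hk a b h := by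
    have hk' := Nat.lt_succ_of_lt hk
    have hab : B.Composable hk'.le (B.one a) (B.one b) := by
      rw [PreCat.Composable, OmegaCat.dIter_succ hk.le, OmegaCat.cIter_succ hk.le]
      exact (congrArg _ ((B.lawful m).d_one a)).trans
        (h.trans (congrArg _ ((B.lawful m).c_one b)).symm)
    have he : B.comp k (B.one a) (B.one b) = B.one (B.comp k a b) :=
      (B.lawful m).one_comp_one hk a b h
    refine (TermClass.comp_mk hk' hab _ _).trans ((TermClass.mk_eq_mk.2
      ⟨_, Proves.one_comp_one hk' ⟨a, rfl⟩ ⟨b, rfl⟩ ⟨_, he.symm⟩ hab⟩).trans ?_)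
    -- The two identity symbols are indexed by cells that are equal, but not definitionally so.
    have key : ∀ {e f : B.cell (m + 1)} (_ : e = f) (he : B.IsOne e) (hf : B.IsOne f),
        (TermClass.mk (one e he) : TermClass B (m + 1) I) = TermClass.mk (one f hf) := by
      rintro e _ rfl he hf
      rfl
    exact key he _ _

/-- The extension of `B_m` whose `(m+1)`-cells are terms up to provable equality. -/
noncomputable def termExtension (B : OmegaCat.{u}) (m : ℕ) (I : Set (B.cell (m + 1))) :
    Extension B m where
  toLayer := termLayer B m I
  lawful := termLayer_lawful B m I

/-- The equational system of strict higher categories is complete for freely generated cells. -/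
theorem exists_proves (hI : B.FreelyGeneratedBy n I) {w : B.cell n} (t s : CTerm B n I w) :
    ∃ χ, Proves t s χ := by
  cases n with
  | zero =>
    cases t with
    | indet _ hx =>
      cases s with
      | indet => exact ⟨_, Proves.refl _⟩
      | one _ he => exact he.elim
      | comp k hk => exact absurd hk (Nat.not_lt_zero _)
    | one _ he => exact he.elim
    | comp k hk => exact absurd hk (Nat.not_lt_zero _)
  | succ m =>
    -- Freeness of `B_{m+1}` over `B_m`, applied to the extension made of terms modulo provability.
    obtain ⟨E, hE, -⟩ := hI (termExtension B m I) (fun x => TermClass.mk (indet x.1 x.2))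
      (fun x => ⟨rfl, rfl⟩)
    -- The left side does not depend on `t`, so any two terms for `w` lie in the same class.
    have key : ∀ {w : B.cell (m + 1)} (t : CTerm B (m + 1) I w), E.toFun w = TermClass.mk t := by
      intro w t
      induction t with
      | indet x hx => exact hE ⟨x, hx⟩
      | one e he =>
        obtain ⟨a, rfl⟩ := he
        exact E.map_one a
      | comp k hk h t s iht ihs =>
        refine (E.map_comp (Nat.lt_succ_iff.1 hk) _ _ ((OmegaCat.composable_succ hk).1 h)).trans ?_
        rw [iht, ihs]
        exact TermClass.comp_mk hk h t s
    exact TermClass.mk_eq_mk.1 ((key t).symm.trans (key s))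

end CTerm
/-! ### Cells of a freely generated extension -/

/-- The identity functor. -/
def ExtHom.id {B : OmegaCat.{u}} {n : ℕ} (X : Extension B n) : ExtHom X X :=
  ⟨fun x => x, fun _ => rfl, fun _ => rfl, fun _ => rfl, fun _ _ _ _ => rfl⟩

theorem ExtHom.composable {B : OmegaCat.{u}} {n : ℕ} {X Y : Extension B n} (F : ExtHom X Y)
    {k : ℕ} {hk : k ≤ n} {x y : X.Top} (h : X.Composable hk x y) :
    Y.Composable hk (F.toFun x) (F.toFun y) := by
  unfold Layer.Composable
  rw [F.map_d, F.map_c]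
  exact h

/-- The composite of two functors. -/
def ExtHom.trans {B : OmegaCat.{u}} {n : ℕ} {X Y Z : Extension B n} (F : ExtHom X Y)
    (G : ExtHom Y Z) : ExtHom X Z where
  toFun x := G.toFun (F.toFun x)
  map_d x := (G.map_d _).trans (F.map_d x)
  map_c x := (G.map_c _).trans (F.map_c x)
  map_one a := (congrArg _ (F.map_one a)).trans (G.map_one a)
  map_comp hk x y h := (congrArg _ (F.map_comp hk x y h)).trans
    (G.map_comp hk _ _ (F.composable h))

/-- An `ω`-functor out of a freely generated extension is determined by its values at the
generators. -/
theorem Extension.FreelyGeneratedBy.hom_ext {B : OmegaCat.{u}} {n : ℕ} {X Y : Extension B n}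
    {J : Set X.Top} (hJ : X.FreelyGeneratedBy J) {F G : ExtHom X Y}
    (h : ∀ x ∈ J, F.toFun x = G.toFun x) : F = G := by
  obtain ⟨H, -, hH⟩ := hJ Y (fun x => F.toFun x) (fun x => ⟨F.map_d x, F.map_c x⟩)
  exact (hH F fun _ => rfl).trans (hH G fun x => (h x x.2).symm).symm

/-! ### Boundaries of composites in a layer -/

namespace Layer

variable {B : OmegaCat.{u}} {n : ℕ} {X : Layer B.toPreCat n}

/-- Composability of `(n+1)`-cells below the top dimension, in terms of the domains. -/
theorem Lawful.composable_iff_d (hX : X.Lawful) {k : ℕ} (hk : k < n) {x y : X.Top} :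
    X.Composable hk.le x y ↔ B.Composable hk.le (X.d x) (X.d y) := by
  unfold Layer.Composable PreCat.Composable
  rw [OmegaCat.Parallel.cIter_eq (hX.parallel y) hk]

theorem Lawful.dIter_comp_right (hX : X.Lawful) {l k : ℕ} (hl : l ≤ k) (hk : k ≤ n) {x y : X.Top}
    (h : X.Composable hk x y) :
    B.dIter (hl.trans hk) (X.d (X.comp k x y)) = B.dIter (hl.trans hk) (X.d y) := by
  rcases hk.eq_or_lt with rfl | hlt
  · rw [hX.d_comp_top x y h]
  · rw [hX.d_comp hlt x y h]
    exact OmegaCat.dIter_comp_right hl hlt ((hX.composable_iff_d hlt).1 h)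

theorem Lawful.cIter_comp_left (hX : X.Lawful) {l k : ℕ} (hl : l ≤ k) (hk : k ≤ n) {x y : X.Top}
    (h : X.Composable hk x y) :
    B.cIter (hl.trans hk) (X.c (X.comp k x y)) = B.cIter (hl.trans hk) (X.c x) := by
  rcases hk.eq_or_lt with rfl | hlt
  · rw [hX.c_comp_top x y h]
  · rw [hX.c_comp hlt x y h]
    exact OmegaCat.cIter_comp_left hl hlt ((hX.composable_iff hlt).1 h)

theorem Lawful.dIter_eq (hX : X.Lawful) {l k : ℕ} (hl : l < k) (hk : k ≤ n) {x y : X.Top}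
    (h : X.Composable hk x y) :
    B.dIter (hl.le.trans hk) (X.d x) = B.dIter (hl.le.trans hk) (X.d y) := by
  rcases hk.eq_or_lt with rfl | hlt
  · rw [composable_top.1 h, OmegaCat.Parallel.dIter_eq (hX.parallel y) hl]
  · exact OmegaCat.Composable.dIter_eq hl hlt ((hX.composable_iff_d hlt).1 h)

theorem Lawful.cIter_eq (hX : X.Lawful) {l k : ℕ} (hl : l < k) (hk : k ≤ n) {x y : X.Top}
    (h : X.Composable hk x y) :
    B.cIter (hl.le.trans hk) (X.c x) = B.cIter (hl.le.trans hk) (X.c y) := by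
  rcases hk.eq_or_lt with rfl | hlt
  · rw [← composable_top.1 h, OmegaCat.Parallel.cIter_eq (hX.parallel x) hl]
  · exact OmegaCat.Composable.cIter_eq hl hlt ((hX.composable_iff hlt).1 h)

theorem Lawful.composable_comp_comp (hX : X.Lawful) {l k : ℕ} (hl : l < k) (hk : k ≤ n)
    {x x₁ y y₁ : X.Top} (h : X.Composable hk x x₁) (h' : X.Composable hk y y₁)
    (h₁ : X.Composable (hl.le.trans hk) x y) (h₂ : X.Composable (hl.le.trans hk) x₁ y₁) :
    X.Composable hk (X.comp l x y) (X.comp l x₁ y₁) := by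
  have hln := hl.trans_le hk
  unfold Layer.Composable
  rw [hX.d_comp hln x y h₁, hX.c_comp hln x₁ y₁ h₂,
    OmegaCat.dIter_comp hl hk ((hX.composable_iff_d hln).1 h₁),
    OmegaCat.cIter_comp hl hk ((hX.composable_iff hln).1 h₂)]
  exact congrArg₂ _ h h'

end Layer

/-! ### Induction over the cells of a free extension -/

namespace Extension

variable {B : OmegaCat.{u}} {n : ℕ}

open Classical in
/-- The extension formed by the cells satisfying a predicate that is closed under the operations. -/
noncomputable def sub (X : Extension B n) (P : X.Top → Prop) (hone : ∀ a, P (X.one a))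
    (hcomp : ∀ {k} (hk : k ≤ n) x y, X.Composable hk x y → P x → P y → P (X.comp k x y)) :
    Extension B n where
  Top := {x // P x}
  d x := X.d x.1
  c x := X.c x.1
  one a := ⟨X.one a, hone a⟩
  -- Closure is assumed for composable pairs only; elsewhere `x` is a filler value.
  comp k x y := if h : P (X.comp k x.1 y.1) then ⟨_, h⟩ else x
  lawful := by
    have hX := X.lawful
    have eq : ∀ {k} (hk : k ≤ n) (x y : {x // P x}) (h : X.Composable hk x.1 y.1),
        (if h : P (X.comp k x.1 y.1) then (⟨_, h⟩ : {x // P x}) else x) =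
          ⟨X.comp k x.1 y.1, hcomp hk x.1 y.1 h x.2 y.2⟩ := fun hk x y h =>
      dif_pos (hcomp hk x.1 y.1 h x.2 y.2)
    have key : ∀ {k} (hk : k ≤ n) (x y : {x // P x}), X.Composable hk x.1 y.1 →
        (if h : P (X.comp k x.1 y.1) then (⟨_, h⟩ : {x // P x}) else x).1 =
          X.comp k x.1 y.1 := fun hk x y h => congrArg Subtype.val (eq hk x y h)
    exact
      { parallel := fun x => hX.parallel x.1
        d_one := hX.d_one
        c_one := hX.c_one
        d_comp_top := fun x y h => (congrArg X.d (key _ x y h)).trans (hX.d_comp_top _ _ h)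
        c_comp_top := fun x y h => (congrArg X.c (key _ x y h)).trans (hX.c_comp_top _ _ h)
        d_comp := fun hk x y h => (congrArg X.d (key _ x y h)).trans (hX.d_comp hk _ _ h)
        c_comp := fun hk x y h => (congrArg X.c (key _ x y h)).trans (hX.c_comp hk _ _ h)
        assoc := by
          intro k hk x y z h h'
          change X.Composable hk x.1 y.1 at h
          change X.Composable hk y.1 z.1 at h'
          dsimp only
          rw [eq hk x y h, eq hk y z h',
            eq hk ⟨_, hcomp hk _ _ h x.2 y.2⟩ z ((hX.dIter_comp_right le_rfl hk h).trans h'),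
            eq hk x ⟨_, hcomp hk _ _ h' y.2 z.2⟩
              (Eq.trans h (hX.cIter_comp_left le_rfl hk h').symm)]
          exact Subtype.ext (hX.assoc hk _ _ _ h h')
        exchange := by
          intro l k hlk hk x x₁ y y₁ h h' h''
          have hl := hlk.le.trans hk
          change X.Composable hk x.1 x₁.1 at h
          change X.Composable hk y.1 y₁.1 at h'
          change X.Composable hl x.1 y.1 at h''
          have h₁ : X.Composable hl x₁.1 y₁.1 :=
            ((hX.dIter_eq hlk hk h).symm.trans h'').trans (hX.cIter_eq hlk hk h')
          dsimp only
          rw [eq hk x x₁ h, eq hk y y₁ h', eq hl x y h'', eq hl x₁ y₁ h₁,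
            eq hl ⟨_, hcomp hk _ _ h x.2 x₁.2⟩ ⟨_, hcomp hk _ _ h' y.2 y₁.2⟩
              (((hX.dIter_comp_right hlk.le hk h).trans (hX.dIter_eq hlk hk h).symm).trans
              (h''.trans (hX.cIter_comp_left hlk.le hk h').symm)),
            eq hk ⟨_, hcomp hl _ _ h'' x.2 y.2⟩ ⟨_, hcomp hl _ _ h₁ x₁.2 y₁.2⟩
              (hX.composable_comp_comp hlk hk h h' h'' h₁)]
          exact Subtype.ext (hX.exchange hlk hk _ _ _ _ h h' h'')
        one_comp := fun hk x => Subtype.ext ((key hk ⟨_, hone _⟩ x ((congrArg _ (hX.d_one _)).trans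
          (OmegaCat.dIter_oneIter _ _))).trans (hX.one_comp hk x.1))
        comp_one := fun hk x => Subtype.ext ((key hk x ⟨_, hone _⟩ (((congrArg _ (hX.c_one _)).trans
          (OmegaCat.cIter_oneIter _ _)).symm)).trans (hX.comp_one hk x.1))
        one_comp_one := fun hk a b h => Subtype.ext ((key hk.le _ _
          ((hX.composable_iff hk).2 (by rw [hX.c_one, hX.c_one]; exact h))).trans
            (hX.one_comp_one hk a b h)) }

/-- Induction over the cells of a freely generated extension. -/
theorem FreelyGeneratedBy.induction {X : Extension B n} {J : Set X.Top}
    (hJ : X.FreelyGeneratedBy J) {P : X.Top → Prop} (hgen : ∀ x ∈ J, P x)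
    (hone : ∀ a, P (X.one a))
    (hcomp : ∀ {k} (hk : k ≤ n) x y, X.Composable hk x y → P x → P y → P (X.comp k x y))
    (x : X.Top) : P x := by
  obtain ⟨F, hF, -⟩ := hJ (X.sub P hone hcomp) (fun x => ⟨x.1, hgen x x.2⟩)
    (fun x => ⟨rfl, rfl⟩)
  let G : ExtHom (X.sub P hone hcomp) X :=
    { toFun := Subtype.val
      map_d := fun _ => rfl
      map_c := fun _ => rfl
      map_one := fun _ => rfl
      map_comp := fun hk x y h => congrArg Subtype.val (dif_pos (hcomp hk x.1 y.1 h x.2 y.2)) }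
  -- The retraction onto the subextension followed by the inclusion fixes `J`, hence is the
  -- identity; so every cell lies in the subextension.
  have hFG : F.trans G = ExtHom.id X := hJ.hom_ext fun x hx => congrArg Subtype.val (hF ⟨x, hx⟩)
  have := (F.toFun x).2
  rwa [show (F.toFun x).1 = x from congrArg (fun H : ExtHom X X => H.toFun x) hFG] at this

/-! ### Decomposition into whiskered generators -/

variable {I : Set (B.cell n)}

/-- The cells built by `•_n` from identities and from the whiskered cells of `J`. -/
inductive WhiskerGenerated (I : Set (B.cell n)) (X : Extension B n) (J : Set X.Top) : X.Top → Prop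
  | one (a : B.cell n) : WhiskerGenerated I X J (X.one a)
  | whisker {w : B.cell n} (t : CTerm B n I w) (r : t.Occ) (f : X.Top) (hf : f ∈ J)
      (h : X.c f = t.label r) : WhiskerGenerated I X J (t.whisker X r f)
  | comp (x y : X.Top) (h : X.d x = X.c y) (hx : WhiskerGenerated I X J x)
      (hy : WhiskerGenerated I X J y) : WhiskerGenerated I X J (X.comp n x y)

theorem one_comp_one_top (X : Extension B n) (a : B.cell n) :
    X.comp n (X.one a) (X.one a) = X.one a := by
  have := X.lawful.one_comp_top (X.one a)
  rwa [X.lawful.c_one] at this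

/-- A further identity factor is absorbed into the term of a whiskered generator; the family `T`
provides a term for it. Across `•_n` the factor distributes by exchange, because `1_a = 1_a •_n
1_a`. -/
theorem WhiskerGenerated.comp_one (T : ∀ w, CTerm B n I w) {X : Extension B n} {J : Set X.Top}
    {k : ℕ} (hk : k < n) {x : X.Top} (hx : WhiskerGenerated I X J x) (a : B.cell n)
    (h : B.Composable hk.le (X.c x) a) : WhiskerGenerated I X J (X.comp k x (X.one a)) := by
  have hX := X.lawful
  induction hx with
  | one b =>
    rw [hX.c_one] at h
    rw [hX.one_comp_one hk b a h]
    exact .one _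
  | whisker t r f hf hr =>
    rw [(CTerm.whisker_dc X t r f hr).2] at h
    exact .whisker (t.comp k hk h (T a)) (.inl r) f hf hr
  | comp x y hxy _ _ ihx ihy =>
    rw [hX.c_comp_top x y (Layer.composable_top.2 hxy)] at h
    have h' : B.Composable hk.le (X.c y) a := by
      rw [← hxy]
      exact (OmegaCat.Parallel.dIter_eq (hX.parallel x) hk).trans h
    have e : X.comp k (X.comp n x y) (X.one a) =
        X.comp n (X.comp k x (X.one a)) (X.comp k y (X.one a)) := by
      rw [← hX.exchange hk le_rfl x y (X.one a) (X.one a) (Layer.composable_top.2 hxy)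
        (Layer.composable_top.2 (by rw [hX.d_one, hX.c_one]))
        ((hX.composable_iff hk).2 (by rwa [hX.c_one])), one_comp_one_top]
    rw [e]
    refine .comp _ _ ?_ (ihx h) (ihy h')
    rw [hX.d_comp hk _ _ ((hX.composable_iff hk).2 (by rwa [hX.c_one])),
      hX.c_comp hk _ _ ((hX.composable_iff hk).2 (by rwa [hX.c_one])), hX.d_one, hX.c_one, hxy]

theorem WhiskerGenerated.one_comp (T : ∀ w, CTerm B n I w) {X : Extension B n} {J : Set X.Top}
    {k : ℕ} (hk : k < n) {x : X.Top} (hx : WhiskerGenerated I X J x) (a : B.cell n)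
    (h : B.Composable hk.le a (X.c x)) : WhiskerGenerated I X J (X.comp k (X.one a) x) := by
  have hX := X.lawful
  induction hx with
  | one b =>
    rw [hX.c_one] at h
    rw [hX.one_comp_one hk a b h]
    exact .one _
  | whisker t r f hf hr =>
    rw [(CTerm.whisker_dc X t r f hr).2] at h
    exact .whisker ((T a).comp k hk h t) (.inr r) f hf hr
  | comp x y hxy _ _ ihx ihy =>
    rw [hX.c_comp_top x y (Layer.composable_top.2 hxy)] at h
    have h' : B.Composable hk.le a (X.c y) := by
      rw [← hxy]
      exact h.trans (OmegaCat.Parallel.cIter_eq (hX.parallel x) hk).symm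
    have e : X.comp k (X.one a) (X.comp n x y) =
        X.comp n (X.comp k (X.one a) x) (X.comp k (X.one a) y) := by
      rw [← hX.exchange hk le_rfl (X.one a) (X.one a) x y
        (Layer.composable_top.2 (by rw [hX.d_one, hX.c_one])) (Layer.composable_top.2 hxy)
        ((hX.composable_iff hk).2 (by rwa [hX.c_one])), one_comp_one_top]
    rw [e]
    refine .comp _ _ ?_ (ihx h) (ihy h')
    rw [hX.d_comp hk _ _ ((hX.composable_iff hk).2 (by rwa [hX.c_one])),
      hX.c_comp hk _ _ ((hX.composable_iff hk).2 (by rwa [hX.c_one])), hX.d_one, hX.c_one, hxy]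

/-- Below the top dimension, composition decomposes into whiskerings. -/
theorem comp_eq_comp_whisker (X : Extension B n) {k : ℕ} (hk : k < n) {x y : X.Top}
    (h : X.Composable hk.le x y) :
    X.comp k x y = X.comp n (X.comp k x (X.one (X.c y))) (X.comp k (X.one (X.d x)) y) := by
  have hX := X.lawful
  rw [← hX.exchange hk le_rfl x (X.one (X.d x)) (X.one (X.c y)) y
    (Layer.composable_top.2 (hX.c_one _).symm) (Layer.composable_top.2 (hX.d_one _))
    ((hX.composable_iff hk).2 (by rw [hX.c_one]; exact (hX.composable_iff hk).1 h)),
    hX.comp_one_top, hX.one_comp_top]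

/-- In a freely generated extension every cell is built by `•_n` from identities and whiskered
generators. -/
theorem FreelyGeneratedBy.whiskerGenerated (T : ∀ w, CTerm B n I w) {X : Extension B n}
    {J : Set X.Top} (hJ : X.FreelyGeneratedBy J) (hJI : ∀ f ∈ J, X.c f ∈ I) (x : X.Top) :
    WhiskerGenerated I X J x := by
  have hX := X.lawful
  -- A generator is its own whiskering in the term consisting of the single indet `cf`.
  refine hJ.induction (fun f hf => .whisker (.indet _ (hJI f hf)) () f hf rfl) .one ?_ x
  intro k hk x y h hx hy
  rcases hk.eq_or_lt with rfl | hlt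
  · exact .comp x y (Layer.composable_top.1 h) hx hy
  · rw [X.comp_eq_comp_whisker hlt h]
    refine .comp _ _ ?_ (hx.comp_one T hlt _ ((hX.composable_iff hlt).1 h))
      (hy.one_comp T hlt _ h)
    rw [hX.d_comp hlt _ _ ((hX.composable_iff hlt).2
      (by rw [hX.c_one]; exact (hX.composable_iff hlt).1 h)),
      hX.c_comp hlt _ _ ((hX.composable_iff hlt).2 (by rw [hX.c_one]; exact h)),
      hX.d_one, hX.c_one]

/-- Functors preserve generalized whiskering. -/
theorem map_whisker {X Y : Extension B n} (F : ExtHom X Y) {w : B.cell n} (t : CTerm B n I w)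
    (r : t.Occ) (v : X.Top) (hv : X.c v = t.label r) :
    F.toFun (t.whisker X r v) = t.whisker Y r (F.toFun v) := by
  have hX := X.lawful
  induction t with
  | indet => rfl
  | one => exact nomatch r
  | comp k hk h t s iht ihs =>
    rcases r with r | r
    · have hc := (CTerm.whisker_dc X t r v hv).2
      refine (F.map_comp hk.le _ _ ((hX.composable_iff hk).2 (by rwa [hX.c_one, hc]))).trans ?_
      rw [iht r hv, F.map_one]
      rfl
    · have hc := (CTerm.whisker_dc X s r v hv).2
      refine (F.map_comp hk.le _ _ ((hX.composable_iff hk).2 (by rwa [hX.c_one, hc]))).trans ?_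
      rw [ihs r hv, F.map_one]
      rfl

end Extension
/-! ### Occurrences in a replacement -/

namespace CTerm

variable {B : OmegaCat.{u}} {n : ℕ} {I : Set (B.cell n)}

/-- The laws of a morphism describe `θ` of a composite only at the old and the new places; that
these exhaust all places makes `θ` determined. -/
theorem exists_substOld_or_substNew {w : B.cell n} (t : CTerm B n I w) (r : t.Occ) {v : B.cell n}
    (s : CTerm B n I v) (hv : B.Parallel v (t.label r)) (p : (t.subst r s hv).Occ) :
    (∃ q hq, t.substOld r s hv q hq = p) ∨ ∃ q, t.substNew r s hv q = p := by
  induction t with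
  | indet => exact .inr ⟨p, rfl⟩
  | one => exact nomatch r
  | comp k hk h t₁ t₂ ih₁ ih₂ =>
    rcases r with r | r
    · rcases p with p | p
      · rcases ih₁ r hv p with ⟨q, hq, rfl⟩ | ⟨q, rfl⟩
        · exact .inl ⟨.inl q, fun e => hq (Sum.inl.inj e), rfl⟩
        · exact .inr ⟨q, rfl⟩
      · exact .inl ⟨.inr p, Sum.inr_ne_inl, rfl⟩
    · rcases p with p | p
      · exact .inl ⟨.inl p, Sum.inl_ne_inr, rfl⟩
      · rcases ih₂ r hv p with ⟨q, hq, rfl⟩ | ⟨q, rfl⟩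
        · exact .inl ⟨.inr q, fun e => hq (Sum.inr.inj e), rfl⟩
        · exact .inr ⟨q, rfl⟩

end CTerm

namespace Occurrences

variable {B : OmegaCat.{u}} {n : ℕ} {I : Set (B.cell n)} (O : Occurrences B n I)

theorem castIdx_heq {v w : B.cell n} (h : v = w) (r : O.Idx v) : HEq (O.castIdx h r) r :=
  cast_heq _ r

theorem heq_of_subsingleton {v w : B.cell n} (h : v = w) [Subsingleton (O.Idx w)] (r : O.Idx v)
    (s : O.Idx w) : HEq r s := by
  subst h
  exact heq_of_eq (Subsingleton.elim r s)

/-- An indet has exactly one indet occurrence. -/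
theorem subsingleton_idx (hI : B.FreelyGeneratedBy n I) {x : B.cell n} (hx : x ∈ I) :
    Subsingleton (O.Idx x) := by
  obtain ⟨χ, -⟩ := CTerm.exists_proves hI (O.term x) (.indet x hx)
  exact Equiv.subsingleton (show O.Idx x ≃ Unit from χ)

/-- The choice of `chi` depends on the `n`-cells and the place alone, not on the extension. It is
therefore the same for `X` and for `Z`, up to transport along equality of domains. -/
theorem chi_substOld_heq {w w' v v' : B.cell n} (hw : w = w') (hv : v = v')
    {r : O.Idx w} {r' : O.Idx w'} (hr : HEq r r') {q : O.Idx w} {q' : O.Idx w'} (hq : HEq q q')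
    (p : B.Parallel v ((O.term w).label r)) (p' : B.Parallel v' ((O.term w').label r'))
    (ne : q ≠ r) (ne' : q' ≠ r') :
    HEq (O.chi w r v p ((O.term w).substOld r (O.term v) p q ne))
      (O.chi w' r' v' p' ((O.term w').substOld r' (O.term v') p' q' ne')) := by
  subst hw hv
  cases hr
  cases hq
  rfl

theorem chi_substNew_heq {w w' v v' : B.cell n} (hw : w = w') (hv : v = v')
    {r : O.Idx w} {r' : O.Idx w'} (hr : HEq r r') {q : O.Idx v} {q' : O.Idx v'} (hq : HEq q q')
    (p : B.Parallel v ((O.term w).label r)) (p' : B.Parallel v' ((O.term w').label r')) :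
    HEq (O.chi w r v p ((O.term w).substNew r (O.term v) p q))
      (O.chi w' r' v' p' ((O.term w').substNew r' (O.term v') p' q')) := by
  subst hw hv
  cases hr
  cases hq
  rfl

end Occurrences

/-! ### Morphisms of multicategories that agree with a functor -/

namespace Extension

variable {B : OmegaCat.{u}} {n : ℕ} {I : Set (B.cell n)} {O : Occurrences B n I}
  {X Z : Extension B n}

theorem exists_old_or_new (a b : X.ManyToOne I) (r : O.Idx (X.d a.1))
    (h : (X.multicat O).tgt b = (X.multicat O).typeOf ((X.multicat O).src a r))
    (p : (X.multicat O).Idx ((X.multicat O).comp a r b h)) :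
    (∃ q hq, (X.multicat O).old a r b h q hq = p) ∨ ∃ q, (X.multicat O).new a r b h q = p := by
  have hl : X.c b.1 = O.label r := congrArg Subtype.val h
  set e := (O.chi (X.d a.1) r (X.d b.1) (X.d_parallel_label O a.1 r b.1 hl)).trans
    (O.castIdx (X.placedComp_dc O a.1 r b.1 hl).1.symm) with he
  rcases CTerm.exists_substOld_or_substNew (O.term (X.d a.1)) r (O.term (X.d b.1))
    (X.d_parallel_label O a.1 r b.1 hl) (e.symm p) with ⟨q, hq, hp⟩ | ⟨q, hp⟩
  · exact .inl ⟨q, hq, (Equiv.symm_apply_eq e).1 hp.symm |>.symm⟩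
  · exact .inr ⟨q, (Equiv.symm_apply_eq e).1 hp.symm |>.symm⟩

/-- The cells of `Z` are kept as variables equal to the images under `F`, so that `χ a` with its
place `θ_a r` can be inserted; the places live in propositionally equal types, whence the
heterogeneous equality. -/
theorem map_placedComp (F : ExtHom X Z) {a b : X.Top} {r : O.Idx (X.d a)} (h : X.c b = O.label r)
    {a' b' : Z.Top} {r' : O.Idx (Z.d a')} (ha : a' = F.toFun a) (hr : HEq r' r)
    (hb : b' = F.toFun b) : Z.placedComp O a' r' b' = F.toFun (X.placedComp O a r b) := by
  subst ha hb
  have key : ∀ {w w' : B.cell n} (_ : w = w') {r : O.Idx w} {r' : O.Idx w'} (_ : HEq r r')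
      (v : Z.Top), (O.term w).whisker Z r v = (O.term w').whisker Z r' v := by
    rintro w _ rfl r _ ⟨⟩ v
    rfl
  have hw := CTerm.whisker_dc X (O.term (X.d a)) r b h
  unfold placedComp
  rw [F.map_comp le_rfl _ _ (Layer.composable_top.2 hw.2.symm), map_whisker F _ _ _ h,
    key (F.map_d a) hr]

/-- The morphism `χ` acts on the arrow `a` as the functor `F` does, and `θ_a` is the identity. -/
def Agrees (F : ExtHom X Z) (χ : MulticatHom (X.multicat O) (Z.multicat O))
    (a : X.ManyToOne I) : Prop :=
  (χ.arr a).1 = F.toFun a.1 ∧ ∀ r, HEq (χ.theta a r) r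

variable {F : ExtHom X Z} {χ : MulticatHom (X.multicat O) (Z.multicat O)}

theorem Agrees.congr {a b : X.ManyToOne I} (h : Agrees F χ a) (e : a.1 = b.1) : Agrees F χ b := by
  rwa [← Subtype.ext (a1 := a) (a2 := b) e]

theorem Agrees.d_eq {a : X.ManyToOne I} (h : Agrees F χ a) : Z.d (χ.arr a).1 = X.d a.1 :=
  (congrArg Z.d h.1).trans (F.map_d a.1)

/-- As `θ_a` is the identity, `χ` composes at the very place `r` at which `F` does. At old and new
places `θ` of the composite is given by `θ_a` and `θ_b`, again identities. -/
theorem Agrees.comp {a b : X.ManyToOne I} (ha : Agrees F χ a) (hb : Agrees F χ b)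
    (r : O.Idx (X.d a.1))
    (h : (X.multicat O).tgt b = (X.multicat O).typeOf ((X.multicat O).src a r)) :
    Agrees F χ ((X.multicat O).comp a r b h) := by
  refine ⟨(congrArg Subtype.val (χ.arr_comp a r b h)).trans
    (map_placedComp F (congrArg Subtype.val h) ha.1 (ha.2 r) hb.1), fun p => ?_⟩
  rcases exists_old_or_new a b r h p with ⟨q, hq, rfl⟩ | ⟨q, rfl⟩
  · refine (Sigma.ext_iff.1 (χ.theta_old a r b h q hq)).2.trans ?_
    exact (O.castIdx_heq _ _).trans ((O.chi_substOld_heq ha.d_eq hb.d_eq (ha.2 r) (ha.2 q)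
      _ _ _ _).trans (O.castIdx_heq _ _).symm)
  · refine (Sigma.ext_iff.1 (χ.theta_new a r b h q)).2.trans ?_
    exact (O.castIdx_heq _ _).trans ((O.chi_substNew_heq ha.d_eq hb.d_eq (ha.2 r) (hb.2 q)
      _ _).trans (O.castIdx_heq _ _).symm)

/-- A bijection between one-element sets leaves no choice for `θ`. -/
theorem agrees_one (hI : B.FreelyGeneratedBy n I) (hobj : ∀ x : I, χ.obj x = x) {x : B.cell n}
    (hx : x ∈ I) (h : X.c (X.one x) ∈ I) : Agrees F χ ⟨X.one x, h⟩ := by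
  have e : (χ.arr ⟨X.one x, h⟩).1 = Z.one x :=
    congrArg Subtype.val ((χ.arr_ident ⟨x, hx⟩).trans (congrArg _ (hobj ⟨x, hx⟩)))
  refine ⟨e.trans (F.map_one x).symm, fun r => ?_⟩
  have : Subsingleton (O.Idx (X.d (X.one x))) := by
    rw [X.lawful.d_one]
    exact O.subsingleton_idx hI hx
  exact O.heq_of_subsingleton ((congrArg Z.d e).trans
    ((Z.lawful.d_one x).trans (X.lawful.d_one x).symm)) _ _

/-- The factors of a many-to-one cell need not be many-to-one, so agreement cannot be proved for `v`
by itself. The induction lets a many-to-one prefix `a` vary and absorbs `v` into it. -/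
theorem WhiskerGenerated.agrees_comp (hI : B.FreelyGeneratedBy n I) {J : Set X.Top}
    (hJI : ∀ f ∈ J, X.c f ∈ I) (hJ : ∀ f (hf : f ∈ J), Agrees F χ ⟨f, hJI f hf⟩) {v : X.Top}
    (hv : WhiskerGenerated I X J v) {a : X.Top} (ha : X.c a ∈ I) (haF : Agrees F χ ⟨a, ha⟩)
    (hav : X.d a = X.c v) (hc : X.c (X.comp n a v) ∈ I) : Agrees F χ ⟨X.comp n a v, hc⟩ := by
  have hX := X.lawful
  induction hv generalizing a with
  | one b =>
    rw [hX.c_one] at hav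
    subst hav
    exact haF.congr (hX.comp_one_top a).symm
  | whisker t r f hf h =>
    rw [(CTerm.whisker_dc X t r f h).2] at hav
    subst hav
    -- The term `t` is an arbitrary term for `da`; the bijection `ψ` carries `r` to a place of the
    -- preferred term, where the whiskering becomes a placed composition.
    obtain ⟨ψ, hψ⟩ := CTerm.exists_proves hI t (O.term (X.d a))
    exact (haF.comp (hJ f hf) (ψ r)
      (Subtype.ext (h.trans (congrArg Subtype.val (hψ.label_eq r).symm)))).congr
      (congrArg (X.comp n a) (hψ.whisker_eq X r f h).symm)
  | comp x y hxy hx hy ihx ihy =>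
    have hax : X.d a = X.c x := by rwa [hX.c_comp_top x y (Layer.composable_top.2 hxy)] at hav
    have cax := Layer.composable_top.2 hax
    have hc' : X.c (X.comp n a x) ∈ I := by rwa [hX.c_comp_top a x cax]
    have hax' : X.d (X.comp n a x) = X.c y := (hX.d_comp_top a x cax).trans hxy
    -- First `x` is absorbed into `a`, then `y` into the new prefix `a •_n x`.
    exact (ihy hc' (ihx ha haF hax hc') hax'
      (by rwa [hX.c_comp_top _ _ (Layer.composable_top.2 hax')])).congr
      (hX.assoc le_rfl a x y cax (Layer.composable_top.2 hxy))

/-- If the functor `F` and the morphism `χ` agree at the generators, then they agree at all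
many-to-one cells. -/
theorem FreelyGeneratedBy.agrees (hI : B.FreelyGeneratedBy n I) {J : Set X.Top}
    (hJ : X.FreelyGeneratedBy J) (hJI : ∀ f ∈ J, X.c f ∈ I) (hobj : ∀ x : I, χ.obj x = x)
    (hJF : ∀ f (hf : f ∈ J), Agrees F χ ⟨f, hJI f hf⟩) (a : X.ManyToOne I) : Agrees F χ a := by
  have hX := X.lawful
  have h1 : X.c (X.one (X.c a.1)) ∈ I := by rw [hX.c_one]; exact a.2
  have h2 := hX.one_comp_top a.1
  exact ((hJ.whiskerGenerated O.term hJI a.1).agrees_comp hI hJI hJF h1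
    (agrees_one hI hobj a.2 h1) (hX.d_one _) (by rw [h2]; exact a.2)).congr h2

end Extension
end Computad

/-! ### The functor induced by a morphism of multicategories -/

open Computad in
theorem corollaryL (B : Computad.OmegaCat.{u}) (n : ℕ) (I : Set (B.cell n))
    (hI : B.FreelyGeneratedBy n I) (O : Computad.Occurrences B n I)
    (X : Computad.Extension B n) (J : Set X.Top) (hJ : X.FreelyGeneratedBy J)
    (hJI : ∀ f ∈ J, X.c f ∈ I)
    (Z : Computad.Extension B n) (χ : Computad.MulticatHom (X.multicat O) (Z.multicat O))
    (hobj : ∀ x : I, χ.obj x = x)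
    (hd : ∀ (f : X.Top) (hf : f ∈ J), X.d f = Z.d (χ.arr ⟨f, hJI f hf⟩).1)
    (hc : ∀ (f : X.Top) (hf : f ∈ J), Z.c (χ.arr ⟨f, hJI f hf⟩).1 = X.c f)
    (hθ : ∀ (f : X.Top) (hf : f ∈ J) (r : O.Idx (X.d f)),
      χ.theta ⟨f, hJI f hf⟩ r = O.castIdx (hd f hf) r) :
    (∃! F : Computad.ExtHom X Z, ∀ a : X.ManyToOne I, F.toFun a.1 = (χ.arr a).1) ∧
    (∀ J' : Set Z.Top, Z.FreelyGeneratedBy J' → (∀ f ∈ J', Z.c f ∈ I) → χ.IsIso →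
      ∀ F : Computad.ExtHom X Z, (∀ a : X.ManyToOne I, F.toFun a.1 = (χ.arr a).1) → F.IsIso) := by
  refine ⟨?_, ?_⟩
  · obtain ⟨F, hF, -⟩ := hJ Z (fun f => (χ.arr ⟨f.1, hJI f f.2⟩).1)
      (fun f => ⟨(hd f f.2).symm, hc f f.2⟩)
    refine ⟨F, fun a => (hJ.agrees hI hJI hobj (fun f hf => ⟨(hF ⟨f, hf⟩).symm, fun r => ?_⟩)
      a).1.symm, fun G hG => hJ.hom_ext fun f hf => ?_⟩
    · rw [hθ f hf r]
      exact O.castIdx_heq _ r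
    · exact (hG ⟨f, hJI f hf⟩).trans (hF ⟨f, hf⟩).symm
  · rintro J' hJ' hJI' ⟨ψ, -, -, -, -, hψχ, hχψ⟩ F hF
    have hFψ : ∀ b : Z.ManyToOne I, F.toFun (ψ.arr b).1 = b.1 := fun b =>
      (hF (ψ.arr b)).trans (congrArg Subtype.val (hχψ b))
    have hinj : ∀ a a' : X.ManyToOne I, F.toFun a.1 = F.toFun a'.1 → a.1 = a'.1 := by
      intro a a' h
      have h' : χ.arr a = χ.arr a' := Subtype.ext ((hF a).symm.trans (h.trans (hF a')))
      exact congrArg Subtype.val ((hψχ a).symm.trans ((congrArg ψ.arr h').trans (hψχ a')))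
    -- The inverse `ψ` enters only through its values on arrows. That these have the right
    -- boundaries follows from `F (ψ b) = b`, as `F` preserves domains and codomains.
    obtain ⟨G, hG, -⟩ := hJ' X (fun f => (ψ.arr ⟨f.1, hJI' f f.2⟩).1) (fun f =>
      ⟨(F.map_d _).symm.trans (congrArg Z.d (hFψ ⟨f.1, hJI' f f.2⟩)),
        (F.map_c _).symm.trans (congrArg Z.c (hFψ ⟨f.1, hJI' f f.2⟩))⟩)
    have hFG : G.trans F = ExtHom.id Z := hJ'.hom_ext fun f hf =>
      (congrArg F.toFun (hG ⟨f, hf⟩)).trans (hFψ ⟨f, hJI' f hf⟩)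
    have hFG' : ∀ z, F.toFun (G.toFun z) = z := fun z =>
      congrArg (fun H : ExtHom Z Z => H.toFun z) hFG
    -- The cells `G (F f)` and `f` are both many-to-one and have the same image under `F`.
    have hGF : F.trans G = ExtHom.id X := hJ.hom_ext fun f hf =>
      hinj ⟨G.toFun (F.toFun f), by rw [G.map_c, F.map_c]; exact hJI f hf⟩ ⟨f, hJI f hf⟩ (hFG' _)
    exact ⟨G, fun x => congrArg (fun H : ExtHom X X => H.toFun x) hGF, hFG'⟩
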